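/- Let $\ell\ge 1$ and let $Q$ be an irreducible $\ell\times\ell$ matrix with entries in $\{0,1\}$. Let \[ \Sigma=\{(x_n)_{n\in\mathbb Z} : Q_{x_n,x_{n+1}}=1 \text{ for all } n\in\mathbb Z\}\subset\{1,\dots,\ell\}^{\mathbb Z} \] be the associated two-sided (transitive) subshift of finite type, with the left shift $\sigma$. For $\tau>0$ put $\rho_\tau(x,y)=e^{-\tau N(x,y)}$ for $x\neq y$, where $N(x,y)=\max\{N\ge 0 : x_n=y_n \text{ for all } |n|<N\}$, and $\rho_\tau(x,x)=0$. A map $\Sigma\to\operatorname{GL}(d,\mathbb R)$ is called Hölder if it is $\alpha$-Hölder with respect to $\rho_\tau$ for some $\alpha>0$ and $\tau>0$. Let $\mu$ be a fully supported $\sigma$-invariant Borel probability measure on $\Sigma$ with continuous (local) product structure. This means the following. Let $\pi_s(x)=(x_n)_{n<0}$ and $\pi_u(x)=(x_n)_{n\ge 0}$, let $\mu^s=(\pi_s)_*\mu$ and $\mu^u=(\pi_u)_*\mu$, and for each symbol $i$ let $[0;i]=\{x\in\Sigma: x_0=i\}$, identified with $\pi_s([0;i])\times\pi_u([0;i])$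 through $\pi_s\times\pi_u$. Then there is a continuous function $\xi\colon\Sigma\to(0,\infty)$ such that $\mu|_{[0;i]}=\xi\cdot\bigl(\mu^s|_{\pi_s([0;i])}\times\mu^u|_{\pi_u([0;i])}\bigr)$ for every $i$. Let $\lambda\in\mathbb R$ and let $U_\lambda\subset\operatorname{GL}(d,\mathbb R)$ be a Zimmer block of exponent $\lambda$: for some $d_1+\dots+d_k=d$ and some compact subgroups $K_i\subset\operatorname{GL}(d_i,\mathbb R)$, the set $U_\lambda$ consists of all block upper triangular matrices with diagonal blocks $e^{\lambda}M_1,\dots,e^{\lambda}M_k$, where $M_i\in K_i$ for each $i$ (the blocks above the diagonal are arbitrary). Let $A,B\colon\Sigma\to U_\lambda$ be Hölder continuous, and let $C\colon\Sigma\to U_\lambda$ be a $\mu$-measurable function such that \[ A(x)=C(\sigma(x))\,B(x)\,C(x)^{-1}\qquad\text{for $\mu$-a.e. } x\in\Sigma. \] Then there is a Hölder continuous function $\overline C\colon\Sigma\to U_\lambda$ with $C=\overline C$ $\mu$-almost everywhere. -/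

import Mathlib

open MeasureTheory

/-! ### Two-sided subshifts of finite type -/

/-- The two-sided subshift of finite type with transition matrix `Q`, with the topology and the
Borel `σ`-algebra induced from the product `(Fin l)^ℤ`. -/
abbrev SFT {l : ℕ} (Q : Matrix (Fin l) (Fin l) ℤ) : Type :=
  {x : ℤ → Fin l // ∀ n : ℤ, Q (x n) (x (n + 1)) = 1}

namespace SFT

variable {l : ℕ} {Q : Matrix (Fin l) (Fin l) ℤ}

/-- The left shift. -/
def shift (x : SFT Q) : SFT Q :=
  ⟨fun n => x.1 (n + 1), fun n => x.2 (n + 1)⟩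

/-- For `x ≠ y`, the largest `N ≥ 0` such that `x n = y n` whenever `|n| < N`. -/
noncomputable def agreeTime (x y : SFT Q) : ℕ :=
  sSup {N : ℕ | ∀ n : ℤ, |n| < (N : ℤ) → x.1 n = y.1 n}

/-- The metric `ρ_τ(x, y) = e ^ (-τ N(x, y))`, with the value `0` on the diagonal. -/
noncomputable def rho (τ : ℝ) (x y : SFT Q) : ℝ :=
  open Classical in if x = y then 0 else Real.exp (-τ * (agreeTime x y : ℝ))

/-- For distinct points the supremum in `agreeTime` is a maximum. -/
theorem le_agreeTime_iff {x y : SFT Q} (hxy : x ≠ y) (N : ℕ) :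
    N ≤ agreeTime x y ↔ ∀ n : ℤ, |n| < (N : ℤ) → x.1 n = y.1 n := by
  obtain ⟨m, hm⟩ : ∃ m : ℤ, x.1 m ≠ y.1 m := by
    by_contra! h
    exact hxy (Subtype.ext (funext h))
  have hb : BddAbove {N : ℕ | ∀ n : ℤ, |n| < (N : ℤ) → x.1 n = y.1 n} := by
    refine ⟨m.natAbs, fun K hK => ?_⟩
    by_contra! hlt
    exact hm (hK m (by rw [Int.abs_eq_natAbs]; exact_mod_cast hlt))
  have hne : {N : ℕ | ∀ n : ℤ, |n| < (N : ℤ) → x.1 n = y.1 n}.Nonempty :=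
    ⟨0, fun n hn => absurd hn (by simp)⟩
  refine ⟨fun h n hn => ?_, fun h => le_csSup hb h⟩
  have h1 := Nat.sSup_mem hne hb
  exact h1 n (lt_of_lt_of_le hn (by exact_mod_cast h))

/-- The one-sided shift `Σ^u` of admissible futures `(x_n)_{n ≥ 0}`. -/
abbrev Future (Q : Matrix (Fin l) (Fin l) ℤ) : Type :=
  {x : ℕ → Fin l // ∀ n : ℕ, Q (x n) (x (n + 1)) = 1}

/-- The one-sided shift `Σ^s` of admissible pasts `(x_n)_{n < 0}`; the past `(x_n)_{n < 0}` is
recorded as the sequence `n ↦ x_{-1-n}`, `n ≥ 0`. -/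
abbrev Past (Q : Matrix (Fin l) (Fin l) ℤ) : Type :=
  {x : ℕ → Fin l // ∀ n : ℕ, Q (x (n + 1)) (x n) = 1}

/-- The projection `π_u : Σ → Σ^u`. -/
def projU (x : SFT Q) : Future Q :=
  ⟨fun n => x.1 n, fun n => by simpa using x.2 n⟩

/-- The projection `π_s : Σ → Σ^s`. -/
def projS (x : SFT Q) : Past Q :=
  ⟨fun n => x.1 (-1 - n), fun n => by
    have h := x.2 (-1 - ((n + 1 : ℕ) : ℤ))
    have e : (-1 - ((n + 1 : ℕ) : ℤ)) + 1 = -1 - (n : ℤ) := by push_cast; ring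
    rwa [e] at h⟩

/-- The map `π_s × π_u : Σ → Σ^s × Σ^u`. -/
def split (x : SFT Q) : Past Q × Future Q := (projS x, projU x)

theorem split_injective : Function.Injective (split : SFT Q → Past Q × Future Q) := by
  intro x y h
  apply Subtype.ext
  funext n
  have h1 : ∀ k : ℕ, x.1 (-1 - k) = y.1 (-1 - k) := fun k =>
    congrFun (congrArg (fun p : Past Q × Future Q => p.1.1) h) k
  have h2 : ∀ k : ℕ, x.1 k = y.1 k := fun k =>
    congrFun (congrArg (fun p : Past Q × Future Q => p.2.1) h) k
  rcases le_or_gt 0 n with hn | hn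
  · obtain ⟨k, rfl⟩ := Int.eq_ofNat_of_zero_le hn
    exact h2 k
  · have := h1 (-1 - n).toNat
    rwa [show -1 - (((-1 - n).toNat : ℕ) : ℤ) = n by omega] at this

/-- `π_s × π_u` is a measurable embedding, so that pulling back measures along it is meaningful. -/
theorem measurableEmbedding_split :
    MeasurableEmbedding (split : SFT Q → Past Q × Future Q) := by
  have hS : MeasurableSet {x : ℤ → Fin l | ∀ n : ℤ, Q (x n) (x (n + 1)) = 1} := by
    rw [Set.ofPred_forall]
    refine MeasurableSet.iInter fun n => ?_
    have : Measurable fun x : ℤ → Fin l => (x n, x (n + 1)) := by fun_prop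
    exact this (MeasurableSet.of_discrete (s := {p : Fin l × Fin l | Q p.1 p.2 = 1}))
  have : StandardBorelSpace (SFT Q) := hS.standardBorel
  refine Measurable.measurableEmbedding ?_ split_injective
  refine Measurable.prodMk (Measurable.subtype_mk ?_) (Measurable.subtype_mk ?_)
  · exact measurable_pi_lambda _ fun n => (measurable_pi_apply _).comp measurable_subtype_coe
  · exact measurable_pi_lambda _ fun n => (measurable_pi_apply _).comp measurable_subtype_coe

/-- The cylinder `[0; i]`. -/
def cyl (Q : Matrix (Fin l) (Fin l) ℤ) (i : Fin l) : Set (SFT Q) := {x | x.1 0 = i}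

/-- Continuous local product structure: there is a continuous `ξ : Σ → (0, ∞)` such that, for every
symbol `i`, the restriction `μ|[0;i]` is `ξ · (μ^s|π_s[0;i] × μ^u|π_u[0;i])`, where
`μ^s = (π_s)_* μ`, `μ^u = (π_u)_* μ`, and `[0;i]` is identified with `π_s[0;i] × π_u[0;i]` through
`π_s × π_u`. -/
def HasContinuousProductStructure (μ : Measure (SFT Q)) : Prop :=
  ∃ ξ : SFT Q → ℝ, Continuous ξ ∧ (∀ x, 0 < ξ x) ∧
    ∀ i : Fin l,
      μ.restrict (cyl Q i) =
        ((((μ.map projS).restrict (projS '' cyl Q i)).prod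
          ((μ.map projU).restrict (projU '' cyl Q i))).comap split).withDensity
            (fun x => ENNReal.ofReal (ξ x))

/-- A matrix-valued function on a subshift is Hölder if it is `α`-Hölder with respect to `ρ_τ` for
some `α > 0` and `τ > 0`. The estimate is required of each matrix entry, which amounts to the same
estimate in any matrix norm. Since the subshift is compact, for a map into `GL(d, ℝ)` the pointwise
inverse is then Hölder as well. -/
def IsHolder {d : ℕ} (f : SFT Q → GL (Fin d) ℝ) : Prop :=
  ∃ τ : ℝ, 0 < τ ∧ ∃ α : ℝ, 0 < α ∧ ∃ c : ℝ, ∀ (x y : SFT Q) (i j : Fin d),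
    |(f x : Matrix (Fin d) (Fin d) ℝ) i j - (f y : Matrix (Fin d) (Fin d) ℝ) i j| ≤
      c * rho τ x y ^ α

/-- A map into `GL(d, ℝ)` is `μ`-measurable (measurable with respect to the completion of `μ`) if
all its matrix entries are; the entries generate the Borel `σ`-algebra of `GL(d, ℝ)`. -/
def IsAEMeasurableGL {d : ℕ} (μ : Measure (SFT Q)) (f : SFT Q → GL (Fin d) ℝ) : Prop :=
  ∀ i j : Fin d, AEMeasurable (fun x => (f x : Matrix (Fin d) (Fin d) ℝ) i j) μ

end SFT

/-! ### Zimmer blocks -/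

/-- `U ⊆ GL(d, ℝ)` is a Zimmer block of exponent `lam`: the indices `0, …, d - 1` are cut into `k`
consecutive blocks (the fibres of a monotone surjection `b`), there are compact groups `K i` of
invertible real matrices of the size of the `i`-th block, and `U` consists of all block upper
triangular matrices whose `i`-th diagonal block is `e ^ lam • M` with `M ∈ K i`. -/
def IsZimmerBlock {d : ℕ} (lam : ℝ) (U : Set (GL (Fin d) ℝ)) : Prop :=
  ∃ (k : ℕ) (b : Fin d → Fin k), Monotone b ∧ Function.Surjective b ∧
    ∃ K : ∀ i : Fin k, Subgroup (GL {p : Fin d // b p = i} ℝ),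
      (∀ i, IsCompact (K i : Set (GL {p : Fin d // b p = i} ℝ))) ∧
      ∀ g : GL (Fin d) ℝ, g ∈ U ↔
        (g : Matrix (Fin d) (Fin d) ℝ).BlockTriangular b ∧
        ∀ i : Fin k, ∃ M ∈ K i,
          (g : Matrix (Fin d) (Fin d) ℝ).toSquareBlock b i =
            Real.exp lam • (M : Matrix {p : Fin d // b p = i} {p : Fin d // b p = i} ℝ)

/-!
Dividing `A` and `B` by `e ^ lam` leaves the equation `A x * C x = C (shift x) * B x` valid and puts
the diagonal blocks of `A` and `B` into compact groups. The off-diagonal entries of products of `A`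
along orbits may grow polynomially, so the equation is not attacked as a whole: it is solved one
block superdiagonal at a time. Modulo lower superdiagonals, which are Hölder by induction and form
an inhomogeneous term `ψ`, the `r`-th superdiagonal `v` of `C` solves
`v (shift x) * D' x = D x * v x + ψ x`, where `D` and `D'` are the block diagonal parts of `A` and
`B` (`aeHolder_entry_of_conjugacy`). Left and right multiplication by `D` and `D'` are isometries of
one seminorm `p`, the supremum of the norm over orbits of the compact groups
(`exists_invariant_seminorm`).

For such an affine isometric equation, consider two points `x`, `y` with asymptotic forward orbits.
Since `D` and `D'` are isometric, `p (v x - v y)` and `p (v (shift^[n] x) - v (shift^[n] y))` differ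
by a sum of errors that is bounded independently of `n`: the errors decay exponentially by Hölder
continuity, up to a factor that grows linearly like `v` along the orbit
(`exists_seminorm_sub_le_iterate`). If the law of the random points `x` and `y` is dominated by a
multiple of `μ`, then so is the law of `shift^[n] x` and `shift^[n] y`, and approximating `v` by a
continuous function shows that `v (shift^[n] x) - v (shift^[n] y)` tends to zero in measure; hence
only the errors remain (`ae_seminorm_sub_le_of_agree_iterate`). The same holds for backward orbits.

The product structure is used for independent points `x`, `y` of one cylinder `[0; i]`: their
bracket `z`, with the past of `x` and the future of `y`, has a law dominated by a multiple of `μ`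
(`exists_map_bracket_le`). Going from `x` to `z` backward in time and from `z` to `y` forward in
time gives a Hölder estimate for `v x - v y` at almost every pair. By Fubini `v` is essentially
bounded, and because `μ` has full support the estimate holds for all pairs from a set of full
measure (`exists_ae_mem_norm_sub_le`). A Hölder function on a subset extends to the whole space, and
the extension of `C` stays in the Zimmer block everywhere because membership is a closed condition
that holds almost everywhere.
-/

namespace SFT

open Filter Topology
open scoped ENNReal

variable {l : ℕ} {Q : Matrix (Fin l) (Fin l) ℤ}

/-! ### Agreement of sequences and Hölder functions -/

/-- The sequences `x` and `y` have the same coordinates on the window `|n| < N`. -/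
def Agree (N : ℕ) (x y : SFT Q) : Prop := ∀ n : ℤ, |n| < (N : ℤ) → x.1 n = y.1 n

theorem Agree.symm {N : ℕ} {x y : SFT Q} (h : Agree N x y) : Agree N y x :=
  fun n hn => (h n hn).symm

theorem Agree.trans {N : ℕ} {x y z : SFT Q} (h : Agree N x y) (h' : Agree N y z) : Agree N x z :=
  fun n hn => (h n hn).trans (h' n hn)

theorem Agree.mono {M N : ℕ} {x y : SFT Q} (h : Agree N x y) (hMN : M ≤ N) : Agree M x y :=
  fun n hn => h n (hn.trans_le (by exact_mod_cast hMN))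

theorem Agree.shift {N : ℕ} {x y : SFT Q} (h : Agree (N + 1) x y) : Agree N (shift x) (shift y) :=
  fun n hn => h (n + 1) (by push_cast; rw [abs_lt] at hn ⊢; omega)

theorem Agree.zero (x y : SFT Q) : Agree 0 x y := fun n hn => absurd hn (by simp)

/-- `f` is Hölder with rate `θ`: it varies by at most `c * θ ^ N` on each cylinder of points with
the same coordinates on `|n| < N`. -/
def HolderWith {E : Type*} [NormedAddCommGroup E] (θ c : ℝ) (f : SFT Q → E) : Prop :=
  ∀ N x y, Agree N x y → ‖f x - f y‖ ≤ c * θ ^ N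

/-- `f` is Hölder, that is `HolderWith θ c` for some rate `θ < 1`. -/
def HolderMap {E : Type*} [NormedAddCommGroup E] (f : SFT Q → E) : Prop :=
  ∃ θ : ℝ, 0 < θ ∧ θ < 1 ∧ ∃ c : ℝ, 0 ≤ c ∧ HolderWith θ c f

section algebra

variable {E F : Type*} [NormedAddCommGroup E] [NormedAddCommGroup F]

theorem HolderWith.mono {θ θ' c c' : ℝ} {f : SFT Q → E} (h : HolderWith θ c f) (hθ : 0 ≤ θ)
    (hc : 0 ≤ c) (hθ' : θ ≤ θ') (hc' : c ≤ c') : HolderWith θ' c' f := fun N x y hxy =>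
  (h N x y hxy).trans (by have := hc.trans hc'; gcongr)

theorem HolderMap.const (a : E) : HolderMap (fun _ : SFT Q => a) :=
  ⟨1 / 2, by norm_num, by norm_num, 0, le_rfl, fun N x y _ => by simp⟩

theorem HolderMap.common {f : SFT Q → E} {g : SFT Q → F} (hf : HolderMap f) (hg : HolderMap g) :
    ∃ θ : ℝ, 0 < θ ∧ θ < 1 ∧ ∃ c : ℝ, 0 ≤ c ∧ HolderWith θ c f ∧ HolderWith θ c g := by
  obtain ⟨θ, h0, h1, c, hc, hf⟩ := hf
  obtain ⟨θ', h0', h1', c', hc', hg⟩ := hg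
  exact ⟨max θ θ', lt_max_of_lt_left h0, max_lt h1 h1', max c c', le_max_of_le_left hc,
    hf.mono h0.le hc (le_max_left _ _) (le_max_left _ _),
    hg.mono h0'.le hc' (le_max_right _ _) (le_max_right _ _)⟩

theorem HolderMap.add {f g : SFT Q → E} (hf : HolderMap f) (hg : HolderMap g) :
    HolderMap (fun x => f x + g x) := by
  obtain ⟨θ, h0, h1, c, hc, hf, hg⟩ := hf.common hg
  refine ⟨θ, h0, h1, c + c, by positivity, fun N x y hxy => ?_⟩
  rw [add_sub_add_comm, add_mul]
  exact (norm_add_le _ _).trans (add_le_add (hf N x y hxy) (hg N x y hxy))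

theorem HolderMap.sum {ι : Type*} (s : Finset ι) {f : ι → SFT Q → E}
    (hf : ∀ i ∈ s, HolderMap (f i)) : HolderMap (fun x => ∑ i ∈ s, f i x) := by
  classical
  induction s using Finset.induction_on with
  | empty => simpa using HolderMap.const (Q := Q) (0 : E)
  | insert a s ha ih =>
    simp only [Finset.sum_insert ha]
    exact (hf a (by simp)).add (ih fun i hi => hf i (by simp [hi]))

theorem HolderMap.exists_bound {f : SFT Q → E} (hf : HolderMap f) :
    ∃ R : ℝ, 0 ≤ R ∧ ∀ x, ‖f x‖ ≤ R := by
  obtain ⟨θ, h0, h1, c, hc, hf⟩ := hf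
  by_cases hne : Nonempty (SFT Q)
  · obtain ⟨x₀⟩ := hne
    refine ⟨c + ‖f x₀‖, by positivity, fun x => ?_⟩
    have h := hf 0 x x₀ (Agree.zero _ _)
    have h' := norm_add_le (f x - f x₀) (f x₀)
    rw [sub_add_cancel] at h'
    simp only [pow_zero, mul_one] at h
    linarith
  · exact ⟨0, le_rfl, fun x => (hne ⟨x⟩).elim⟩

theorem HolderMap.mul {f g : SFT Q → ℝ} (hf : HolderMap f) (hg : HolderMap g) :
    HolderMap (fun x => f x * g x) := by
  obtain ⟨R, hR, hfR⟩ := hf.exists_bound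
  obtain ⟨S, hS, hgS⟩ := hg.exists_bound
  obtain ⟨θ, h0, h1, c, hc, hf, hg⟩ := hf.common hg
  refine ⟨θ, h0, h1, R * c + c * S, by positivity, fun N x y hxy => ?_⟩
  rw [show f x * g x - f y * g y = f x * (g x - g y) + (f x - f y) * g y by ring]
  refine (norm_add_le _ _).trans ?_
  rw [norm_mul, norm_mul]
  have h1 : ‖f x‖ * ‖g x - g y‖ ≤ R * (c * θ ^ N) :=
    mul_le_mul (hfR x) (hg N x y hxy) (norm_nonneg _) hR
  have h2 : ‖f x - f y‖ * ‖g y‖ ≤ (c * θ ^ N) * S :=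
    mul_le_mul (hf N x y hxy) (hgS y) (norm_nonneg _) (by positivity)
  linarith

theorem HolderMap.comp_shift {f : SFT Q → E} (hf : HolderMap f) :
    HolderMap (fun x => f (shift x)) := by
  obtain ⟨θ, h0, h1, c, hc, hf⟩ := hf
  refine ⟨θ, h0, h1, c / θ, by positivity, fun N x y hxy => ?_⟩
  rcases N with _ | N
  · refine (hf 0 _ _ (Agree.zero _ _)).trans ?_
    have : c ≤ c / θ := le_div_self hc h0 h1.le
    simpa using this
  · refine (hf N _ _ hxy.shift).trans (le_of_eq ?_)
    field_simp
    ring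

theorem HolderMap.pi {ι : Type*} [Fintype ι] {E : ι → Type*} [∀ i, NormedAddCommGroup (E i)]
    {f : SFT Q → ∀ i, E i} (hf : ∀ i, HolderMap (fun x => f x i)) : HolderMap f := by
  choose θ h0 h1 c hc hf using hf
  obtain ⟨θ', hθ1, hθ0, hle⟩ : ∃ θ' : ℝ, θ' < 1 ∧ 0 < θ' ∧ ∀ i, θ i ≤ θ' := by
    by_cases hι : Nonempty ι
    · obtain ⟨j, hj⟩ := Finite.exists_max θ
      exact ⟨θ j, h1 j, h0 j, hj⟩
    · exact ⟨1 / 2, by norm_num, by norm_num, fun i => (hι ⟨i⟩).elim⟩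
  refine ⟨θ', hθ0, hθ1, ∑ i, c i, Finset.sum_nonneg fun i _ => hc i, fun N x y hxy => ?_⟩
  have hs : 0 ≤ ∑ i, c i := Finset.sum_nonneg fun i _ => hc i
  rw [pi_norm_le_iff_of_nonneg (by positivity)]
  intro i
  exact (hf i).mono (h0 i).le (hc i) (hle i)
    (Finset.single_le_sum (f := c) (fun i _ => hc i) (Finset.mem_univ i)) N x y hxy

theorem HolderMap.clm_comp [NormedSpace ℝ E] [NormedSpace ℝ F] (T : E →L[ℝ] F) {f : SFT Q → E}
    (hf : HolderMap f) : HolderMap (fun x => T (f x)) := by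
  obtain ⟨θ, h0, h1, c, hc, hf⟩ := hf
  refine ⟨θ, h0, h1, ‖T‖ * c, by positivity, fun N x y hxy => ?_⟩
  rw [← map_sub, mul_assoc]
  exact (T.le_opNorm _).trans (by gcongr; exact hf N x y hxy)

/-- The set of points agreeing with `x` on `|n| < N` is open. -/
theorem isOpen_setOf_agree (N : ℕ) (x : SFT Q) : IsOpen {y : SFT Q | Agree N x y} := by
  have : {y : SFT Q | Agree N x y} =
      ⋂ n ∈ Finset.Ioo (-(N : ℤ)) N, {y : SFT Q | x.1 n = y.1 n} := by
    ext y
    simp [Agree, abs_lt]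
  rw [this]
  refine isOpen_biInter_finset fun n _ => ?_
  have hc : Continuous fun y : SFT Q => y.1 n :=
    (continuous_apply n).comp continuous_subtype_val
  exact (isOpen_discrete {a : Fin l | x.1 n = a}).preimage hc

theorem HolderMap.continuous {f : SFT Q → E} (hf : HolderMap f) : Continuous f := by
  obtain ⟨θ, h0, h1, c, hc, hf⟩ := hf
  rw [continuous_iff_continuousAt]
  intro x
  rw [ContinuousAt, Metric.tendsto_nhds]
  intro ε hε
  have ht : Tendsto (fun N : ℕ => c * θ ^ N) atTop (𝓝 (c * 0)) :=
    (tendsto_pow_atTop_nhds_zero_of_lt_one h0.le h1).const_mul c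
  rw [mul_zero] at ht
  obtain ⟨N, hN⟩ := (ht.eventually_lt_const hε).exists
  filter_upwards [(isOpen_setOf_agree N x).mem_nhds (fun n _ => rfl)] with y hy
  rw [dist_eq_norm]
  exact (hf N y x (Agree.symm hy)).trans_lt hN

end algebra

/-! ### The metrics `ρ_τ` -/

theorem rho_self (τ : ℝ) (x : SFT Q) : rho τ x x = 0 := by simp [rho]

theorem rho_of_ne (τ : ℝ) {x y : SFT Q} (h : x ≠ y) :
    rho τ x y = Real.exp (-τ) ^ agreeTime x y := by
  rw [rho, if_neg h, ← Real.exp_nat_mul]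
  ring_nf

theorem rho_nonneg (τ : ℝ) (x y : SFT Q) : 0 ≤ rho τ x y := by
  unfold rho
  split_ifs <;> positivity

theorem agree_agreeTime {x y : SFT Q} (h : x ≠ y) : Agree (agreeTime x y) x y :=
  (le_agreeTime_iff h _).1 le_rfl

theorem rho_comm (τ : ℝ) (x y : SFT Q) : rho τ x y = rho τ y x := by
  by_cases h : x = y
  · rw [h]
  · have : agreeTime x y = agreeTime y x := by
      unfold agreeTime
      simp only [eq_comm]
    rw [rho_of_ne τ h, rho_of_ne τ (Ne.symm h), this]

theorem Agree.rho_le {τ : ℝ} (hτ : 0 < τ) {N : ℕ} {x y : SFT Q} (h : Agree N x y) :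
    rho τ x y ≤ Real.exp (-τ) ^ N := by
  by_cases hxy : x = y
  · rw [hxy, rho_self]
    positivity
  · rw [rho_of_ne τ hxy]
    exact pow_le_pow_of_le_one (Real.exp_pos _).le (by simpa using hτ.le)
      ((le_agreeTime_iff hxy N).2 h)

theorem rho_triangle {τ : ℝ} (hτ : 0 < τ) (x y z : SFT Q) :
    rho τ x z ≤ rho τ x y + rho τ y z := by
  by_cases hxy : x = y
  · simp [hxy, rho_self]
  by_cases hyz : y = z
  · simp [hyz, rho_self]
  -- The distance is in fact an ultrametric.
  have h : Agree (min (agreeTime x y) (agreeTime y z)) x z :=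
    ((agree_agreeTime hxy).mono (min_le_left _ _)).trans
      ((agree_agreeTime hyz).mono (min_le_right _ _))
  refine (h.rho_le hτ).trans ?_
  rcases min_choice (agreeTime x y) (agreeTime y z) with h' | h' <;> rw [h']
  · rw [← rho_of_ne τ hxy]
    exact le_add_of_nonneg_right (rho_nonneg _ _ _)
  · rw [← rho_of_ne τ hyz]
    exact le_add_of_nonneg_left (rho_nonneg _ _ _)

/-- The pseudometric structure given by `ρ_τ`. -/
@[reducible] noncomputable def rhoPseudoMetricSpace {τ : ℝ} (hτ : 0 < τ) :
    PseudoMetricSpace (SFT Q) where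
  dist := rho τ
  dist_self := rho_self τ
  dist_comm := rho_comm τ
  dist_triangle := rho_triangle hτ

theorem exp_neg_neg_log {θ : ℝ} (h0 : 0 < θ) : Real.exp (- -Real.log θ) = θ := by
  rw [neg_neg, Real.exp_log h0]

theorem HolderWith.norm_sub_le_rho {E : Type*} [NormedAddCommGroup E] {θ c : ℝ} (h0 : 0 < θ)
    {f : SFT Q → E} (hf : HolderWith θ c f) (x y : SFT Q) :
    ‖f x - f y‖ ≤ c * rho (-Real.log θ) x y := by
  by_cases h : x = y
  · simp [h, rho_self]
  · rw [rho_of_ne _ h, exp_neg_neg_log h0]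
    exact hf _ x y (agree_agreeTime h)

/-- A real function satisfying a Hölder estimate on a subset extends to a Hölder function. -/
theorem exists_holderMap_extend {f : SFT Q → ℝ} {G : Set (SFT Q)} {θ c : ℝ} (h0 : 0 < θ)
    (h1 : θ < 1) (hc : 0 ≤ c)
    (hf : ∀ N, ∀ x ∈ G, ∀ y ∈ G, Agree N x y → |f x - f y| ≤ c * θ ^ N) :
    ∃ g : SFT Q → ℝ, HolderMap g ∧ ∀ x ∈ G, f x = g x := by
  have hτ : 0 < -Real.log θ := by linarith [Real.log_neg h0 h1]
  let := rhoPseudoMetricSpace (Q := Q) hτ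
  have hL : LipschitzOnWith c.toNNReal f G := by
    refine LipschitzOnWith.of_dist_le_mul fun x hx y hy => ?_
    rw [Real.coe_toNNReal _ hc, Real.dist_eq]
    by_cases h : x = y
    · rw [h]
      simp
    · change _ ≤ c * rho (-Real.log θ) x y
      rw [rho_of_ne _ h, exp_neg_neg_log h0]
      exact hf _ x hx y hy (agree_agreeTime h)
  obtain ⟨g, hg, hfg⟩ := hL.extend_real
  refine ⟨g, ⟨θ, h0, h1, c, hc, fun N x y hxy => ?_⟩, fun x hx => hfg hx⟩
  have h := hg.dist_le_mul x y
  rw [Real.coe_toNNReal _ hc, Real.dist_eq] at h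
  refine h.trans (mul_le_mul_of_nonneg_left ?_ hc)
  have h2 := hxy.rho_le hτ
  rwa [exp_neg_neg_log h0] at h2

theorem IsHolder.holderMap_entry {d : ℕ} {f : SFT Q → GL (Fin d) ℝ} (hf : IsHolder f)
    (i j : Fin d) : HolderMap (fun x => (f x : Matrix (Fin d) (Fin d) ℝ) i j) := by
  obtain ⟨τ, hτ, α, hα, c, hf⟩ := hf
  refine ⟨Real.exp (-τ) ^ α, by positivity,
    Real.rpow_lt_one (Real.exp_pos _).le (by simpa using hτ) hα, |c|, abs_nonneg c,
    fun N x y hxy => ?_⟩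
  refine (hf x y i j).trans ?_
  have h := rho_nonneg τ x y
  calc c * rho τ x y ^ α ≤ |c| * rho τ x y ^ α := by gcongr; exact le_abs_self c
    _ ≤ |c| * (Real.exp (-τ) ^ N) ^ α := by gcongr; exact hxy.rho_le hτ
    _ = |c| * (Real.exp (-τ) ^ α) ^ N := by
      rw [← Real.rpow_natCast, ← Real.rpow_natCast, ← Real.rpow_mul (Real.exp_pos _).le,
        ← Real.rpow_mul (Real.exp_pos _).le, mul_comm α]

theorem isHolder_of_holderMap {d : ℕ} {f : SFT Q → GL (Fin d) ℝ}
    (hf : HolderMap (fun x (i j : Fin d) => (f x : Matrix (Fin d) (Fin d) ℝ) i j)) :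
    IsHolder f := by
  obtain ⟨θ, h0, h1, c, hc, hf⟩ := hf
  refine ⟨-Real.log θ, by linarith [Real.log_neg h0 h1], 1, one_pos, c, fun x y i j => ?_⟩
  rw [Real.rpow_one]
  refine le_trans ?_ (hf.norm_sub_le_rho h0 x y)
  exact (norm_le_pi_norm (((fun i j => (f x : Matrix (Fin d) (Fin d) ℝ) i j) -
    fun i j => (f y : Matrix (Fin d) (Fin d) ℝ) i j) i) j).trans (norm_le_pi_norm
    ((fun i j => (f x : Matrix (Fin d) (Fin d) ℝ) i j) -
    fun i j => (f y : Matrix (Fin d) (Fin d) ℝ) i j) i)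

/-! ### Approximation by continuous functions -/

theorem isClosed_setOf_admissible (Q : Matrix (Fin l) (Fin l) ℤ) :
    IsClosed {x : ℤ → Fin l | ∀ n : ℤ, Q (x n) (x (n + 1)) = 1} := by
  rw [Set.ofPred_forall]
  refine isClosed_iInter fun n => ?_
  have hc : Continuous fun x : ℤ → Fin l => (x n, x (n + 1)) := by fun_prop
  exact (isClosed_discrete {p : Fin l × Fin l | Q p.1 p.2 = 1}).preimage hc

instance : CompactSpace (SFT Q) :=
  isCompact_iff_compactSpace.1 (isClosed_setOf_admissible Q).isCompact

instance : SecondCountableTopology (SFT Q) :=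
  Topology.IsEmbedding.subtypeVal.secondCountableTopology

instance : TopologicalSpace.MetrizableSpace (SFT Q) :=
  TopologicalSpace.metrizableSpace_of_t3_secondCountable _

theorem exists_agree_imp_dist_lt {E : Type*} [PseudoMetricSpace E] {g : SFT Q → E}
    (hg : Continuous g) {δ : ℝ} (hδ : 0 < δ) :
    ∃ N, ∀ x y, Agree N x y → dist (g x) (g y) < δ := by
  by_contra! h
  choose x y hxy hd using h
  let : UniformSpace (Fin l) := ⊥
  have hu : Tendsto (fun n => (x n, y n)) atTop (uniformity (SFT Q)) := by
    rw [uniformity_subtype, tendsto_comap_iff, Pi.uniformity, tendsto_iInf]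
    intro k
    rw [tendsto_comap_iff]
    refine Tendsto.mono_right ?_ refl_le_uniformity
    refine tendsto_principal.2 ?_
    filter_upwards [eventually_gt_atTop k.natAbs] with n hn
    exact hxy n k (by rw [Int.abs_eq_natAbs]; exact_mod_cast hn)
  have := (Metric.uniformity_basis_dist.tendsto_right_iff.1
    (Tendsto.comp (CompactSpace.uniformContinuous_of_continuous hg) hu) δ hδ).exists
  obtain ⟨n, hn⟩ := this
  exact absurd hn (not_lt.2 (hd n))

section approx

variable {V : Type*} [NormedAddCommGroup V] [NormedSpace ℝ V] [MeasurableSpace V] [BorelSpace V]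
  [SecondCountableTopology V]

/-- A measurable function is close to a continuous one outside a set of small measure. -/
theorem exists_continuous_measure_le {α : Type*} [TopologicalSpace α] [NormalSpace α]
    [MeasurableSpace α] [BorelSpace α] (μ : Measure α) [IsFiniteMeasure μ] [μ.WeaklyRegular]
    {v : α → V} (hv : Measurable v) {δ : ℝ} (hδ : 0 < δ) {ε : ℝ≥0∞} (hε : ε ≠ 0) :
    ∃ g : α → V, Continuous g ∧ μ {x | δ ≤ ‖v x - g x‖} ≤ ε := by
  have hε2 : ε / 2 ≠ 0 := by simp [hε]
  -- Truncate `v` at a level `R` that it rarely exceeds, then approximate in `L¹`.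
  obtain ⟨R, hR⟩ : ∃ R : ℕ, μ {x | (R : ℝ) < ‖v x‖} < ε / 2 := by
    have ht : Tendsto (fun R : ℕ => μ {x | (R : ℝ) < ‖v x‖}) atTop
        (𝓝 (μ (⋂ R : ℕ, {x | (R : ℝ) < ‖v x‖}))) := by
      refine tendsto_measure_iInter_atTop
        (fun R => (measurableSet_lt measurable_const hv.norm).nullMeasurableSet) ?_
        ⟨0, measure_ne_top _ _⟩
      intro a b hab x hx
      exact lt_of_le_of_lt (Nat.cast_le.2 hab) (show (b : ℝ) < ‖v x‖ from hx)
    have he : ⋂ R : ℕ, {x | (R : ℝ) < ‖v x‖} = ∅ := by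
      ext x
      simp only [Set.mem_iInter, Set.mem_ofPred_eq, Set.mem_empty_iff_false, iff_false, not_forall,
        not_lt]
      exact exists_nat_ge _
    rw [he, measure_empty] at ht
    exact (ht.eventually_lt_const (pos_iff_ne_zero.2 hε2)).exists
  have hms : MeasurableSet {x | ‖v x‖ ≤ (R : ℝ)} := measurableSet_le hv.norm measurable_const
  set w : α → V := {x | ‖v x‖ ≤ (R : ℝ)}.indicator v with hw
  have hwm : Measurable w := hv.indicator hms
  have hwi : Integrable w μ := by
    refine Integrable.of_bound hwm.aestronglyMeasurable (R : ℝ) (Eventually.of_forall fun x => ?_)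
    by_cases hx : ‖v x‖ ≤ (R : ℝ)
    · rw [hw, Set.indicator_of_mem (by exact hx)]
      exact hx
    · rw [hw, Set.indicator_of_notMem (by exact hx)]
      simp
  have hδ' : ENNReal.ofReal δ ≠ 0 := by simpa using hδ
  obtain ⟨g, hg, -⟩ := hwi.exists_boundedContinuous_lintegral_sub_le
    (ε := ENNReal.ofReal δ * (ε / 2)) (mul_ne_zero hδ' hε2)
  refine ⟨g, g.continuous, ?_⟩
  have hsub : {x | δ ≤ ‖v x - g x‖} ⊆
      {x | (R : ℝ) < ‖v x‖} ∪ {x | ENNReal.ofReal δ ≤ ‖w x - g x‖ₑ} := by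
    intro x hx
    by_cases hxR : ‖v x‖ ≤ (R : ℝ)
    · right
      have : w x = v x := Set.indicator_of_mem (by exact hxR) v
      rw [Set.mem_ofPred_eq, this, ← ofReal_norm]
      exact ENNReal.ofReal_le_ofReal hx
    · left
      exact not_le.1 hxR
  have hmk : μ {x | ENNReal.ofReal δ ≤ ‖w x - g x‖ₑ} ≤ ε / 2 := by
    have h := mul_meas_ge_le_lintegral₀ (μ := μ) (f := fun x => ‖w x - g x‖ₑ)
      ((hwm.sub g.continuous.measurable).enorm.aemeasurable) (ENNReal.ofReal δ)
    have h2 := h.trans hg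
    rwa [ENNReal.mul_le_mul_iff_right hδ' ENNReal.ofReal_ne_top] at h2
  calc _ ≤ _ := measure_mono hsub
    _ ≤ _ := measure_union_le _ _
    _ ≤ ε / 2 + ε / 2 := add_le_add hR.le hmk
    _ = ε := ENNReal.add_halves ε

/-- Two families of points `X`, `Y` whose laws are dominated by the invariant measure `μ`, and whose
orbits under `T` are asymptotic, have asymptotic values of any measurable function, in measure. -/
theorem eventually_measure_agree_norm_sub_le {Ω : Type*} [MeasurableSpace Ω] {m : Measure Ω}
    {μ : Measure (SFT Q)} [IsFiniteMeasure μ] {X Y : Ω → SFT Q} (hX : Measurable X)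
    (hY : Measurable Y) {C : ℝ≥0∞} (hC : C ≠ ∞) (hmX : m.map X ≤ C • μ) (hmY : m.map Y ≤ C • μ)
    {T : SFT Q → SFT Q} (hT : MeasurePreserving T μ μ) {v : SFT Q → V} (hv : Measurable v)
    {δ : ℝ} (hδ : 0 < δ) {ε : ℝ≥0∞} (hε : ε ≠ 0) :
    ∀ᶠ n in atTop, m {ω | Agree n (T^[n] (X ω)) (T^[n] (Y ω)) ∧
      δ ≤ ‖v (T^[n] (X ω)) - v (T^[n] (Y ω))‖} ≤ ε := by
  have hε' : ε / 2 / (C + 1) ≠ 0 := by simp [hε, hC]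
  obtain ⟨g, hg, hgE⟩ := exists_continuous_measure_le μ hv (show 0 < δ / 3 by positivity) hε'
  set E : Set (SFT Q) := {x | δ / 3 ≤ ‖v x - g x‖} with hE
  have hEm : MeasurableSet E := measurableSet_le measurable_const (hv.sub hg.measurable).norm
  obtain ⟨N, hN⟩ := exists_agree_imp_dist_lt hg (show 0 < δ / 3 by positivity)
  have key : ∀ n, ∀ Z : Ω → SFT Q, Measurable Z → m.map Z ≤ C • μ →
      m {ω | T^[n] (Z ω) ∈ E} ≤ ε / 2 := by
    intro n Z hZ hmZ
    have hTn := hT.iterate n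
    have hpre : MeasurableSet (T^[n] ⁻¹' E) := hTn.measurable hEm
    calc m {ω | T^[n] (Z ω) ∈ E} = m.map Z (T^[n] ⁻¹' E) := (Measure.map_apply hZ hpre).symm
      _ ≤ (C • μ) (T^[n] ⁻¹' E) := hmZ _
      _ = C * μ E := by
        rw [Measure.smul_apply, hTn.measure_preimage hEm.nullMeasurableSet, smul_eq_mul]
      _ ≤ (C + 1) * (ε / 2 / (C + 1)) := by gcongr; exact le_self_add
      _ = ε / 2 := ENNReal.mul_div_cancel (by simp) (by simp [hC])
  filter_upwards [eventually_ge_atTop N] with n hn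
  have hsub : {ω | Agree n (T^[n] (X ω)) (T^[n] (Y ω)) ∧
      δ ≤ ‖v (T^[n] (X ω)) - v (T^[n] (Y ω))‖} ⊆
      {ω | T^[n] (X ω) ∈ E} ∪ {ω | T^[n] (Y ω) ∈ E} := by
    rintro ω ⟨hag, hd⟩
    by_contra hnot
    simp only [hE, Set.mem_union, Set.mem_ofPred_eq, not_or, not_le] at hnot
    have h1 := hN _ _ (hag.mono hn)
    rw [dist_eq_norm] at h1
    set a := T^[n] (X ω)
    set b := T^[n] (Y ω)
    have h2 : v a - v b = (v a - g a) + (g a - g b) - (v b - g b) := by abel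
    have h3 := norm_sub_le ((v a - g a) + (g a - g b)) (v b - g b)
    have h4 := norm_add_le (v a - g a) (g a - g b)
    rw [← h2] at h3
    linarith [hnot.1, hnot.2]
  calc _ ≤ _ := measure_mono hsub
    _ ≤ _ := measure_union_le _ _
    _ ≤ ε / 2 + ε / 2 := add_le_add (key n X hX hmX) (key n Y hY hmY)
    _ = ε := ENNReal.add_halves ε

end approx

/-! ### Comparison along asymptotic orbits -/

section orbit

variable {V : Type*} [NormedAddCommGroup V] [NormedSpace ℝ V] {p : Seminorm ℝ V}
  {v : SFT Q → V} {S : Set (SFT Q)} {T : SFT Q → SFT Q} {θ c Φ : ℝ}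

/-- The constant `K` is `c * ∑ θ ^ k (1 + k Φ)`: the errors made at time `k` are summable because
`p (v (T^[k] x))` grows at most linearly. -/
theorem exists_seminorm_sub_le_iterate (h0 : 0 < θ) (h1 : θ < 1) (hc : 0 ≤ c) (hΦ : 0 ≤ Φ)
    (hgrow : ∀ a ∈ S, p (v (T a)) ≤ p (v a) + Φ)
    (hstep : ∀ N, ∀ a ∈ S, ∀ b ∈ S, Agree N a b → Agree N (T a) (T b) →
      p (v a - v b) ≤ p (v (T a) - v (T b)) + c * θ ^ N * (1 + p (v a))) :
    ∃ K : ℝ, 0 ≤ K ∧ ∀ (N : ℕ) (x y : SFT Q), (∀ k, T^[k] x ∈ S) → (∀ k, T^[k] y ∈ S) →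
      (∀ k, Agree (N + k) (T^[k] x) (T^[k] y)) → ∀ n,
      p (v x - v y) ≤ p (v (T^[n] x) - v (T^[n] y)) + K * θ ^ N * (1 + p (v x)) := by
  have hsum : Summable fun k : ℕ => θ ^ k * (1 + k * Φ) := by
    have e1 : Summable fun k : ℕ => θ ^ k := summable_geometric_of_lt_one h0.le h1
    have e2 : Summable fun k : ℕ => (k : ℝ) ^ 1 * θ ^ k :=
      summable_pow_mul_geometric_of_norm_lt_one 1 (by rwa [Real.norm_of_nonneg h0.le])
    refine (e1.add (e2.mul_left Φ)).congr fun k => ?_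
    ring
  have hterm : ∀ k : ℕ, 0 ≤ θ ^ k * (1 + k * Φ) := fun k => by positivity
  refine ⟨c * ∑' k : ℕ, θ ^ k * (1 + k * Φ), mul_nonneg hc (tsum_nonneg hterm), ?_⟩
  intro N x y hx hy hag n
  have hlin : ∀ k : ℕ, p (v (T^[k] x)) ≤ p (v x) + k * Φ := by
    intro k
    induction k with
    | zero => simp
    | succ k ih =>
      rw [Function.iterate_succ_apply']
      have := hgrow _ (hx k)
      push_cast
      linarith
  have hpx : 0 ≤ p (v x) := apply_nonneg p _
  have hpart : ∀ n : ℕ, p (v x - v y) ≤ p (v (T^[n] x) - v (T^[n] y)) +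
      c * (∑ k ∈ Finset.range n, θ ^ k * (1 + k * Φ)) * θ ^ N * (1 + p (v x)) := by
    intro n
    induction n with
    | zero => simp
    | succ n ih =>
      have hs := hstep (N + n) _ (hx n) _ (hy n) (hag n) (by
        have := hag (n + 1)
        rw [Function.iterate_succ_apply', Function.iterate_succ_apply'] at this
        exact this.mono (by omega))
      rw [Function.iterate_succ_apply', Function.iterate_succ_apply', Finset.sum_range_succ]
      have hk : c * θ ^ (N + n) * (1 + p (v (T^[n] x))) ≤
          c * (θ ^ n * (1 + n * Φ)) * θ ^ N * (1 + p (v x)) := by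
        have : 1 + p (v (T^[n] x)) ≤ (1 + n * Φ) * (1 + p (v x)) := by
          have := hlin n
          have h' : 0 ≤ (n : ℝ) * Φ * p (v x) := by positivity
          linarith
        calc _ ≤ c * θ ^ (N + n) * ((1 + n * Φ) * (1 + p (v x))) := by gcongr
          _ = _ := by rw [pow_add]; ring
      have e : c * (∑ k ∈ Finset.range n, θ ^ k * (1 + k * Φ) + θ ^ n * (1 + n * Φ)) * θ ^ N *
          (1 + p (v x)) = c * (∑ k ∈ Finset.range n, θ ^ k * (1 + k * Φ)) * θ ^ N *
          (1 + p (v x)) + c * (θ ^ n * (1 + n * Φ)) * θ ^ N * (1 + p (v x)) := by ring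
      rw [e]
      linarith
  refine (hpart n).trans ?_
  gcongr
  exact hsum.sum_le_tsum _ fun k _ => hterm k

variable [MeasurableSpace V] [BorelSpace V] [SecondCountableTopology V]

/-- Along asymptotic orbits the difference `v (T^[n] (X ω)) - v (T^[n] (Y ω))` tends to zero in
measure, while it controls `v (X ω) - v (Y ω)` up to an error uniform in `n`; only the error
remains. -/
theorem ae_seminorm_sub_le_of_agree_iterate {μ : Measure (SFT Q)} [IsFiniteMeasure μ]
    (hT : MeasurePreserving T μ μ) (hv : Measurable v) {M : ℝ} (hpM : ∀ u, p u ≤ M * ‖u‖)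
    (hS : ∀ᵐ x ∂μ, x ∈ S) {K : ℝ}
    (hK : ∀ (N : ℕ) (x y : SFT Q), (∀ k, T^[k] x ∈ S) → (∀ k, T^[k] y ∈ S) →
      (∀ k, Agree (N + k) (T^[k] x) (T^[k] y)) → ∀ n,
      p (v x - v y) ≤ p (v (T^[n] x) - v (T^[n] y)) + K * θ ^ N * (1 + p (v x)))
    {Ω : Type*} [MeasurableSpace Ω] {m : Measure Ω} {X Y : Ω → SFT Q} (hX : Measurable X)
    (hY : Measurable Y) {C : ℝ≥0∞} (hC : C ≠ ∞) (hmX : m.map X ≤ C • μ) (hmY : m.map Y ≤ C • μ) :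
    ∀ᵐ ω ∂m, ∀ N : ℕ, (∀ k, Agree (N + k) (T^[k] (X ω)) (T^[k] (Y ω))) →
      p (v (X ω) - v (Y ω)) ≤ K * θ ^ N * (1 + p (v (X ω))) := by
  have horb : ∀ᵐ x ∂μ, ∀ k, T^[k] x ∈ S :=
    ae_all_iff.2 fun k => (hT.iterate k).quasiMeasurePreserving.ae hS
  have hpull : ∀ Z : Ω → SFT Q, Measurable Z → m.map Z ≤ C • μ →
      ∀ᵐ ω ∂m, ∀ k, T^[k] (Z ω) ∈ S := by
    intro Z hZ hmZ
    refine ae_of_ae_map (p := fun x => ∀ k, T^[k] x ∈ S) hZ.aemeasurable ?_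
    exact (Measure.absolutelyContinuous_of_le hmZ).ae_le
      ((Measure.smul_absolutelyContinuous).ae_le horb)
  have hδ : ∀ᵐ ω ∂m, ∀ j N : ℕ, (∀ k, Agree (N + k) (T^[k] (X ω)) (T^[k] (Y ω))) →
      p (v (X ω) - v (Y ω)) ≤ K * θ ^ N * (1 + p (v (X ω))) + 1 / ((j : ℝ) + 1) := by
    rw [ae_all_iff]
    intro j
    set δ : ℝ := 1 / ((j : ℝ) + 1) with hδ
    have hδ0 : 0 < δ := by positivity
    have hM : 0 < |M| + 1 := by positivity
    have hbad : m {ω | (∀ k, T^[k] (X ω) ∈ S) ∧ (∀ k, T^[k] (Y ω) ∈ S) ∧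
        ¬ ∀ N : ℕ, (∀ k, Agree (N + k) (T^[k] (X ω)) (T^[k] (Y ω))) →
        p (v (X ω) - v (Y ω)) ≤ K * θ ^ N * (1 + p (v (X ω))) + δ} = 0 := by
      by_contra hne
      obtain ⟨ε, hε0, hε⟩ := exists_between (pos_iff_ne_zero.2 hne)
      obtain ⟨n, hn⟩ := (eventually_measure_agree_norm_sub_le hX hY hC hmX hmY hT hv
        (div_pos hδ0 hM) hε0.ne').exists
      refine absurd (hn.trans_lt hε) (not_lt.2 (measure_mono ?_))
      rintro ω ⟨hx, hy, hnot⟩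
      push Not at hnot
      obtain ⟨N, hag, hlt⟩ := hnot
      refine ⟨(hag n).mono (by omega), ?_⟩
      have h1 := hK N _ _ hx hy hag n
      have h2 := hpM (v (T^[n] (X ω)) - v (T^[n] (Y ω)))
      rw [div_le_iff₀ hM, mul_comm]
      have h3 : M * ‖v (T^[n] (X ω)) - v (T^[n] (Y ω))‖ ≤
          (|M| + 1) * ‖v (T^[n] (X ω)) - v (T^[n] (Y ω))‖ := by
        gcongr
        linarith [le_abs_self M]
      linarith
    filter_upwards [hpull X hX hmX, hpull Y hY hmY, measure_eq_zero_iff_ae_notMem.1 hbad]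
      with ω hx hy hω
    by_contra hnot
    exact hω ⟨hx, hy, hnot⟩
  filter_upwards [hδ] with ω hω N hag
  refine le_of_forall_pos_le_add fun ε hε => ?_
  obtain ⟨j, hj⟩ := exists_nat_one_div_lt hε
  exact (hω j N hag).trans (by linarith)

end orbit

/-! ### The inverse shift and the bracket -/

/-- The right shift, inverse to `shift`. -/
def shiftInv (x : SFT Q) : SFT Q :=
  ⟨fun n => x.1 (n - 1), fun n => by
    have h := x.2 (n - 1)
    rwa [show n - 1 + 1 = n + 1 - 1 by ring] at h⟩

theorem shift_shiftInv (x : SFT Q) : shift (shiftInv x) = x :=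
  Subtype.ext (funext fun n => by simp [shift, shiftInv])

theorem shiftInv_shift (x : SFT Q) : shiftInv (shift x) = x :=
  Subtype.ext (funext fun n => by simp [shift, shiftInv])

theorem measurable_coord (n : ℤ) : Measurable fun x : SFT Q => x.1 n :=
  (measurable_pi_apply n).comp measurable_subtype_coe

theorem measurable_shiftInv : Measurable (shiftInv : SFT Q → SFT Q) :=
  Measurable.subtype_mk (measurable_pi_lambda _ fun n => measurable_coord (n - 1))

theorem measurePreserving_shiftInv {μ : Measure (SFT Q)} (h : MeasurePreserving shift μ μ) :
    MeasurePreserving shiftInv μ μ :=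
  MeasurePreserving.symm (⟨⟨shift, shiftInv, shiftInv_shift, shift_shiftInv⟩, h.measurable,
    measurable_shiftInv⟩ : SFT Q ≃ᵐ SFT Q) h

theorem shift_iterate_apply (k : ℕ) (x : SFT Q) (n : ℤ) : (shift^[k] x).1 n = x.1 (n + k) := by
  induction k generalizing n with
  | zero => simp
  | succ k ih =>
    rw [Function.iterate_succ_apply']
    change (shift^[k] x).1 (n + 1) = _
    rw [ih, show n + 1 + (k : ℤ) = n + ((k + 1 : ℕ) : ℤ) by push_cast; ring]

theorem shiftInv_iterate_apply (k : ℕ) (x : SFT Q) (n : ℤ) :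
    (shiftInv^[k] x).1 n = x.1 (n - k) := by
  induction k generalizing n with
  | zero => simp
  | succ k ih =>
    rw [Function.iterate_succ_apply']
    change (shiftInv^[k] x).1 (n - 1) = _
    rw [ih, show n - 1 - (k : ℤ) = n - ((k + 1 : ℕ) : ℤ) by push_cast; ring]

/-- The bracket of two points with the same symbol at `0`: the past of `x` followed by the future
of `y`. If the symbols at `0` differ, the value is `y`. -/
def bracket (x y : SFT Q) : SFT Q :=
  ⟨fun n => if x.1 0 = y.1 0 ∧ n < 0 then x.1 n else y.1 n, fun n => by
    by_cases h : x.1 0 = y.1 0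
    · rcases lt_trichotomy (n + 1) 0 with hn | hn | hn
      · simpa [h, hn, show n < 0 by omega] using x.2 n
      · have := x.2 n
        rw [hn, h] at this
        simpa [h, hn, show n < 0 by omega] using this
      · simpa [show ¬ n < 0 by omega, show ¬ n + 1 < 0 by omega] using y.2 n
    · simpa [h] using y.2 n⟩

theorem bracket_apply_of_nonpos {x y : SFT Q} (h : x.1 0 = y.1 0) {n : ℤ} (hn : n ≤ 0) :
    (bracket x y).1 n = x.1 n := by
  rcases hn.lt_or_eq with hn | rfl
  · simp [bracket, h, hn]
  · simp [bracket, h]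

theorem bracket_apply_of_nonneg (x y : SFT Q) {n : ℤ} (hn : 0 ≤ n) :
    (bracket x y).1 n = y.1 n := by
  simp [bracket, not_lt.2 hn]

theorem split_bracket {x y : SFT Q} (h : x.1 0 = y.1 0) :
    split (bracket x y) = (projS x, projU y) := by
  refine Prod.ext (Subtype.ext (funext fun n => ?_)) (Subtype.ext (funext fun n => ?_))
  · exact bracket_apply_of_nonpos h (by omega)
  · exact bracket_apply_of_nonneg x y (by positivity)

theorem measurable_bracket : Measurable fun w : SFT Q × SFT Q => bracket w.1 w.2 := by
  refine Measurable.subtype_mk (measurable_pi_lambda _ fun n => ?_)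
  have h1 : Measurable fun w : SFT Q × SFT Q => w.1.1 n := (measurable_coord n).comp measurable_fst
  have h2 : Measurable fun w : SFT Q × SFT Q => w.2.1 n := (measurable_coord n).comp measurable_snd
  by_cases hn : n < 0
  · simp only [hn, and_true]
    exact Measurable.ite (measurableSet_eq_fun ((measurable_coord 0).comp measurable_fst)
      ((measurable_coord 0).comp measurable_snd)) h1 h2
  · simpa only [hn, and_false, if_false] using h2

theorem agree_iterate_shiftInv_bracket {N : ℕ} (hN : 1 ≤ N) {x y : SFT Q} (h : Agree N x y)
    (k : ℕ) : Agree (N + k) (shiftInv^[k] x) (shiftInv^[k] (bracket x y)) := by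
  intro n hn
  rw [shiftInv_iterate_apply, shiftInv_iterate_apply]
  rw [abs_lt] at hn
  push_cast at hn
  rcases le_total (n - k) 0 with h' | h'
  · rw [bracket_apply_of_nonpos (h 0 (by simp; omega)) h']
  · rw [bracket_apply_of_nonneg x y h']
    exact h _ (by rw [abs_lt]; omega)

theorem agree_iterate_shift_bracket {N : ℕ} (hN : 1 ≤ N) {x y : SFT Q} (h : Agree N x y)
    (k : ℕ) : Agree (N + k) (shift^[k] (bracket x y)) (shift^[k] y) := by
  intro n hn
  rw [shift_iterate_apply, shift_iterate_apply]
  rw [abs_lt] at hn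
  push_cast at hn
  rcases le_total (n + k) 0 with h' | h'
  · rw [bracket_apply_of_nonpos (h 0 (by simp; omega)) h']
    exact h _ (by rw [abs_lt]; omega)
  · rw [bracket_apply_of_nonneg x y h']

theorem measurableSet_cyl (i : Fin l) : MeasurableSet (cyl Q i) :=
  measurable_coord 0 (measurableSet_singleton i)

theorem measurable_projS : Measurable (projS : SFT Q → Past Q) :=
  measurable_fst.comp measurableEmbedding_split.measurable

theorem measurable_projU : Measurable (projU : SFT Q → Future Q) :=
  measurable_snd.comp measurableEmbedding_split.measurable

theorem map_restrict_le {α β : Type*} [MeasurableSpace α] [MeasurableSpace β] (μ : Measure α)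
    {f : α → β} (hf : Measurable f) (s : Set α) :
    (μ.restrict s).map f ≤ (μ.map f).restrict (f '' s) := by
  refine Measure.le_intro fun E hE _ => ?_
  rw [Measure.map_apply hf hE, Measure.restrict_apply (hf hE), Measure.restrict_apply hE]
  refine le_trans (measure_mono ?_) (Measure.le_map_apply hf.aemeasurable _)
  exact fun x hx => ⟨hx.1, Set.mem_image_of_mem f hx.2⟩

/-- The content of the product structure used below: for independent points `x`, `y` of one cylinder
`[0; i]`, the law of the bracket is dominated by a multiple of `μ`. -/
theorem exists_map_bracket_le {μ : Measure (SFT Q)} [IsProbabilityMeasure μ]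
    (hprod : HasContinuousProductStructure μ) :
    ∃ C : ℝ≥0∞, 1 ≤ C ∧ C ≠ ∞ ∧ ∀ i : Fin l,
      ((μ.restrict (cyl Q i)).prod (μ.restrict (cyl Q i))).map
        (fun w : SFT Q × SFT Q => bracket w.1 w.2) ≤ C • μ := by
  obtain ⟨ξ, hξ, hpos, hμ⟩ := hprod
  have hne : (Set.univ : Set (SFT Q)).Nonempty := by
    by_contra h
    have := measure_univ (μ := μ)
    rw [Set.not_nonempty_iff_eq_empty.1 h, measure_empty] at this
    exact zero_ne_one this
  obtain ⟨x₀, -, hx₀⟩ := isCompact_univ.exists_isMinOn hne hξ.continuousOn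
  set a : ℝ≥0∞ := ENNReal.ofReal (ξ x₀) with ha
  have ha0 : a ≠ 0 := by simpa [ha] using hpos x₀
  refine ⟨max 1 a⁻¹, le_max_left _ _, by simp [ha0], fun i => ?_⟩
  set μi := μ.restrict (cyl Q i) with hμi
  set νs := (μ.map projS).restrict (projS '' cyl Q i)
  set νu := (μ.map projU).restrict (projU '' cyl Q i)
  set κ := (νs.prod νu).comap split
  have hκ : ∀ E, MeasurableSet E → a * κ E ≤ μ E := by
    intro E hE
    calc a * κ E = ∫⁻ _ in E, a ∂κ := (setLIntegral_const E a).symm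
      _ ≤ ∫⁻ x in E, ENNReal.ofReal (ξ x) ∂κ :=
        lintegral_mono fun x => ENNReal.ofReal_le_ofReal (hx₀ (Set.mem_univ x))
      _ = μi E := by rw [hμi, hμ i, withDensity_apply _ hE]
      _ ≤ μ E := Measure.restrict_apply_le _ _
  refine Measure.le_intro fun E hE _ => ?_
  have hcyl : ∀ᵐ w ∂(μi.prod μi), w.1.1 0 = w.2.1 0 := by
    rw [hμi, Measure.prod_restrict]
    filter_upwards [ae_restrict_mem ((measurableSet_cyl i).prod (measurableSet_cyl i))] with w hw
    exact Eq.trans hw.1 (Eq.symm hw.2)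
  have hle : (μi.prod μi).map (fun w : SFT Q × SFT Q => bracket w.1 w.2) E ≤ κ E := by
    rw [Measure.map_apply measurable_bracket hE, measurableEmbedding_split.comap_apply]
    have hE' := measurableEmbedding_split.measurableSet_image.2 hE
    calc (μi.prod μi) ((fun w : SFT Q × SFT Q => bracket w.1 w.2) ⁻¹' E)
        ≤ (μi.prod μi) (Prod.map projS projU ⁻¹' (split '' E)) := by
          refine measure_mono_ae ?_
          filter_upwards [hcyl] with w hw hwE
          exact ⟨_, hwE, split_bracket hw⟩
      _ = ((μi.map projS).prod (μi.map projU)) (split '' E) := by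
          rw [Measure.map_prod_map _ _ measurable_projS measurable_projU,
            Measure.map_apply (measurable_projS.prodMap measurable_projU) hE']
      _ ≤ (νs.prod νu) (split '' E) :=
          Measure.prod_mono (map_restrict_le μ measurable_projS _)
            (map_restrict_le μ measurable_projU _) _
  refine hle.trans ?_
  rw [Measure.smul_apply, smul_eq_mul]
  have haT : a ≠ ∞ := ENNReal.ofReal_ne_top
  calc κ E = a⁻¹ * (a * κ E) := by rw [← mul_assoc, ENNReal.inv_mul_cancel ha0 haT, one_mul]
    _ ≤ max 1 a⁻¹ * μ E := mul_le_mul' (le_max_right _ _) (hκ E hE)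

/-! ### Regularity of solutions of affine isometric equations -/

section regularity

variable {V : Type*} [NormedAddCommGroup V] [NormedSpace ℝ V]

/-- One step of the comparison. The hypothesis is symmetric in the roles of `ℓ`, `u` and `r`, `u'`,
up to the sign of `s`, so the bound serves for forward and for backward orbits. -/
theorem seminorm_sub_le_of_affine {p : Seminorm ℝ V} {ℓ ℓ' r r' : V →L[ℝ] V} {u u' w w' s s' : V}
    (hℓ : ∀ z, p (ℓ' z) = p z) (hr : ∀ z, p (r' z) = p z)
    (h : r u' = ℓ u + s) (h' : r' w' = ℓ' w + s') :
    p (u - w) ≤ p (u' - w') + (p ((r - r') u') + p ((ℓ - ℓ') u) + p (s - s')) := by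
  have e : ℓ' (u - w) = r' (u' - w') + ((r - r') u' - (ℓ - ℓ') u - (s - s')) := by
    simp only [map_sub, sub_apply, h, h']
    abel
  rw [← hℓ, e, ← hr (u' - w')]
  refine (map_add_le_add p _ _).trans ?_
  gcongr
  exact (map_sub_le_add p _ _).trans (add_le_add_left (map_sub_le_add p _ _) _)

variable [MeasurableSpace V] [BorelSpace V] [SecondCountableTopology V]

/-- Almost every pair of points of one cylinder satisfies a Hölder estimate: go from `x` to the
bracket along negative times and from the bracket to `y` along positive times. -/
theorem exists_ae_ae_seminorm_sub_le {μ : Measure (SFT Q)} [IsProbabilityMeasure μ]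
    (hinv : MeasurePreserving shift μ μ) (hprod : HasContinuousProductStructure μ)
    {p : Seminorm ℝ V} {M : ℝ} (hM : 0 ≤ M) (hp : ∀ u, ‖u‖ ≤ p u) (hpM : ∀ u, p u ≤ M * ‖u‖)
    {L R : SFT Q → V →L[ℝ] V} {ψ : SFT Q → V} (hL : HolderMap L) (hR : HolderMap R)
    (hψ : HolderMap ψ) (hLp : ∀ x u, p (L x u) = p u) (hRp : ∀ x u, p (R x u) = p u)
    {v : SFT Q → V} (hv : Measurable v)
    (heq : ∀ᵐ x ∂μ, R x (v (shift x)) = L x (v x) + ψ x) :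
    ∃ θ : ℝ, 0 < θ ∧ θ < 1 ∧ ∃ K : ℝ, 0 ≤ K ∧ ∀ᵐ x ∂μ, ∀ᵐ y ∂μ, ∀ N, 1 ≤ N → Agree N x y →
      p (v x - v y) ≤ K * θ ^ N * (1 + p (v x)) := by
  obtain ⟨B, hB0, hB⟩ := hψ.exists_bound
  obtain ⟨θ, h0, h1, c₀, hc₀, hL, hR, hψ⟩ : ∃ θ : ℝ, 0 < θ ∧ θ < 1 ∧ ∃ c : ℝ, 0 ≤ c ∧
      HolderWith θ c L ∧ HolderWith θ c R ∧ HolderWith θ c ψ := by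
    obtain ⟨θ₁, h0₁, h1₁, c₁, hc₁, hL, hR⟩ := hL.common hR
    obtain ⟨θ₂, h0₂, h1₂, c₂, hc₂, hψ⟩ := hψ
    exact ⟨max θ₁ θ₂, lt_max_of_lt_left h0₁, max_lt h1₁ h1₂, max c₁ c₂, le_max_of_le_left hc₁,
      hL.mono h0₁.le hc₁ (le_max_left _ _) (le_max_left _ _),
      hR.mono h0₁.le hc₁ (le_max_left _ _) (le_max_left _ _),
      hψ.mono h0₂.le hc₂ (le_max_right _ _) (le_max_right _ _)⟩
  set Φ : ℝ := M * B
  have hΦ : 0 ≤ Φ := mul_nonneg hM hB0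
  have hψΦ : ∀ x, p (ψ x) ≤ Φ := fun x => (hpM _).trans (mul_le_mul_of_nonneg_left (hB x) hM)
  set c : ℝ := M * c₀ * (2 + Φ)
  have hc : 0 ≤ c := by positivity
  set S : Set (SFT Q) := {x | R x (v (shift x)) = L x (v x) + ψ x}
  have hgrow : ∀ a ∈ S, p (v (shift a)) ≤ p (v a) + Φ := by
    intro a ha
    rw [← hRp a (v (shift a)), ha, ← hLp a (v a)]
    exact (map_add_le_add p _ _).trans (add_le_add_right (hψΦ a) _)
  have hgrow' : ∀ a ∈ S, p (v a) ≤ p (v (shift a)) + Φ := by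
    intro a ha
    rw [← hLp a (v a), eq_sub_iff_add_eq.2 (Eq.symm ha), ← hRp a (v (shift a))]
    exact (map_sub_le_add p _ _).trans (add_le_add_right (hψΦ a) _)
  have herr : ∀ (H : SFT Q → V →L[ℝ] V), HolderWith θ c₀ H → ∀ N a b u, Agree N a b →
      p ((H a - H b) u) ≤ M * c₀ * θ ^ N * p u := by
    intro H hH N a b u hab
    calc p ((H a - H b) u) ≤ M * (‖H a - H b‖ * ‖u‖) :=
          (hpM _).trans (mul_le_mul_of_nonneg_left ((H a - H b).le_opNorm u) hM)
      _ ≤ M * ((c₀ * θ ^ N) * p u) := by gcongr; exacts [hH N a b hab, hp u]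
      _ = _ := by ring
  have herr' : ∀ N a b, Agree N a b → p (ψ a - ψ b) ≤ M * c₀ * θ ^ N := by
    intro N a b hab
    rw [mul_assoc]
    exact (hpM _).trans (mul_le_mul_of_nonneg_left (hψ N a b hab) hM)
  have hsum : ∀ (N : ℕ) (u u' : V), p u' ≤ p u + Φ →
      M * c₀ * θ ^ N * p u' + M * c₀ * θ ^ N * p u + M * c₀ * θ ^ N ≤
        c * θ ^ N * (1 + p u) := by
    intro N u u' hu
    have h2 : p u' + p u + 1 ≤ (2 + Φ) * (1 + p u) := by
      have : 0 ≤ Φ * p u := mul_nonneg hΦ (apply_nonneg p u)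
      linarith
    calc _ = M * c₀ * θ ^ N * (p u' + p u + 1) := by ring
      _ ≤ M * c₀ * θ ^ N * ((2 + Φ) * (1 + p u)) := by gcongr
      _ = _ := by ring
  have hS : ∀ᵐ x ∂μ, x ∈ S := heq
  have hinv' := measurePreserving_shiftInv hinv
  obtain ⟨K₂, hK₂0, hK₂⟩ := exists_seminorm_sub_le_iterate (p := p) (v := v) (S := S) (T := shift)
    h0 h1 hc hΦ hgrow (by
      intro N a ha b hb hab _
      refine (seminorm_sub_le_of_affine (hLp b) (hRp b) ha hb).trans ?_
      gcongr
      exact (add_le_add (add_le_add (herr R hR N a b _ hab) (herr L hL N a b _ hab))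
        (herr' N a b hab)).trans (hsum N _ _ (hgrow a ha)))
  obtain ⟨K₁, hK₁0, hK₁⟩ := exists_seminorm_sub_le_iterate (p := p) (v := v)
    (S := shiftInv ⁻¹' S) (T := shiftInv) h0 h1 hc hΦ
    (by
      intro a ha
      have := hgrow' _ ha
      rwa [shift_shiftInv] at this)
    (by
      intro N a ha b hb _ hab
      have hg := hgrow' _ ha
      -- The equation at `shiftInv a`, read from right to left, with inhomogeneous term `-ψ`.
      have ha' : R (shiftInv a) (v (shift (shiftInv a))) =
        L (shiftInv a) (v (shiftInv a)) + ψ (shiftInv a) := ha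
      have hb' : R (shiftInv b) (v (shift (shiftInv b))) =
        L (shiftInv b) (v (shiftInv b)) + ψ (shiftInv b) := hb
      rw [shift_shiftInv] at ha' hb' hg
      rw [← sub_eq_iff_eq_add, sub_eq_add_neg] at ha' hb'
      refine (seminorm_sub_le_of_affine (hRp _) (hLp _) ha'.symm hb'.symm).trans ?_
      gcongr
      have hneg : p (-ψ (shiftInv a) - -ψ (shiftInv b)) = p (ψ (shiftInv a) - ψ (shiftInv b)) := by
        rw [← neg_sub', map_neg_eq_map]
      rw [hneg]
      exact (add_le_add (add_le_add (herr L hL N _ _ _ hab) (herr R hR N _ _ _ hab))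
        (herr' N _ _ hab)).trans (hsum N _ _ hg))
  obtain ⟨C, hC1, hC, hbr⟩ := exists_map_bracket_le hprod
  refine ⟨θ, h0, h1, K₁ + K₂ * (1 + K₁), by positivity, ?_⟩
  have hcyl : ∀ i : Fin l, ∀ᵐ x ∂μ, x ∈ cyl Q i → ∀ᵐ y ∂μ, y ∈ cyl Q i → ∀ N, 1 ≤ N →
      Agree N x y → p (v x - v y) ≤ (K₁ + K₂ * (1 + K₁)) * θ ^ N * (1 + p (v x)) := by
    intro i
    have hle1 : (μ.restrict (cyl Q i)) Set.univ ≤ 1 := by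
      rw [Measure.restrict_apply_univ]
      exact prob_le_one
    have hmarg : (μ.restrict (cyl Q i)) Set.univ • μ.restrict (cyl Q i) ≤ C • μ := by
      refine Measure.le_intro fun E hE _ => ?_
      simp only [Measure.smul_apply, smul_eq_mul]
      exact mul_le_mul' (hle1.trans hC1) (Measure.restrict_apply_le _ _)
    have hf : ((μ.restrict (cyl Q i)).prod (μ.restrict (cyl Q i))).map Prod.fst ≤ C • μ := by
      rw [Measure.map_fst_prod]
      exact hmarg
    have hs : ((μ.restrict (cyl Q i)).prod (μ.restrict (cyl Q i))).map Prod.snd ≤ C • μ := by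
      rw [Measure.map_snd_prod]
      exact hmarg
    have e1 := ae_seminorm_sub_le_of_agree_iterate hinv' hv hpM
      (hinv'.quasiMeasurePreserving.ae hS) hK₁ measurable_fst measurable_bracket hC hf (hbr i)
    have e2 := ae_seminorm_sub_le_of_agree_iterate hinv hv hpM hS hK₂ measurable_bracket
      measurable_snd hC (hbr i) hs
    have e : ∀ᵐ w ∂((μ.restrict (cyl Q i)).prod (μ.restrict (cyl Q i))), ∀ N, 1 ≤ N →
        Agree N w.1 w.2 →
        p (v w.1 - v w.2) ≤ (K₁ + K₂ * (1 + K₁)) * θ ^ N * (1 + p (v w.1)) := by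
      filter_upwards [e1, e2] with w hw1 hw2 N hN hag
      have g1 := hw1 N (agree_iterate_shiftInv_bracket hN hag)
      have g2 := hw2 N (agree_iterate_shift_bracket hN hag)
      set z := bracket w.1 w.2
      have hpx : 0 ≤ p (v w.1) := apply_nonneg p _
      have hz : 1 + p (v z) ≤ (1 + K₁) * (1 + p (v w.1)) := by
        have t1 : p (v z) ≤ p (v w.1) + p (v w.1 - v z) := by
          have := map_sub_le_add p (v w.1) (v w.1 - v z)
          rwa [sub_sub_cancel] at this
        have t2 : K₁ * θ ^ N * (1 + p (v w.1)) ≤ K₁ * (1 + p (v w.1)) := by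
          gcongr
          exact mul_le_of_le_one_right hK₁0 (pow_le_one₀ h0.le h1.le)
        linarith
      calc p (v w.1 - v w.2) ≤ p (v w.1 - v z) + p (v z - v w.2) := by
            have := map_add_le_add p (v w.1 - v z) (v z - v w.2)
            rwa [sub_add_sub_cancel] at this
        _ ≤ K₁ * θ ^ N * (1 + p (v w.1)) + K₂ * θ ^ N * ((1 + K₁) * (1 + p (v w.1))) := by
            refine add_le_add g1 (g2.trans ?_)
            gcongr
        _ = _ := by ring
    have e' := Measure.ae_ae_of_ae_prod e
    rw [ae_restrict_iff' (measurableSet_cyl i)] at e'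
    filter_upwards [e'] with x hx hxi
    exact (ae_restrict_iff' (measurableSet_cyl i)).1 (hx hxi)
  filter_upwards [ae_all_iff.2 hcyl] with x hx
  filter_upwards [hx (x.1 0) rfl] with y hy N hN hag
  exact hy (hag 0 (by simp; omega)).symm N hN hag

/-- A measurable solution `v` of `R x (v (shift x)) = L x (v x) + ψ x`, with `L` and `R` isometric
for one seminorm equivalent to the norm, satisfies a Hölder estimate on a set of full measure. -/
theorem exists_ae_mem_norm_sub_le {μ : Measure (SFT Q)} [IsProbabilityMeasure μ]
    (hinv : MeasurePreserving shift μ μ) (hsupp : μ.IsOpenPosMeasure)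
    (hprod : HasContinuousProductStructure μ)
    {p : Seminorm ℝ V} {M : ℝ} (hM : 0 ≤ M) (hp : ∀ u, ‖u‖ ≤ p u) (hpM : ∀ u, p u ≤ M * ‖u‖)
    {L R : SFT Q → V →L[ℝ] V} {ψ : SFT Q → V} (hL : HolderMap L) (hR : HolderMap R)
    (hψ : HolderMap ψ) (hLp : ∀ x u, p (L x u) = p u) (hRp : ∀ x u, p (R x u) = p u)
    {v : SFT Q → V} (hv : Measurable v)
    (heq : ∀ᵐ x ∂μ, R x (v (shift x)) = L x (v x) + ψ x) :
    ∃ G : Set (SFT Q), (∀ᵐ x ∂μ, x ∈ G) ∧ ∃ θ : ℝ, 0 < θ ∧ θ < 1 ∧ ∃ c : ℝ, 0 ≤ c ∧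
      ∀ N, ∀ x ∈ G, ∀ y ∈ G, Agree N x y → ‖v x - v y‖ ≤ c * θ ^ N := by
  obtain ⟨θ, h0, h1, K, hK, hae⟩ :=
    exists_ae_ae_seminorm_sub_le hinv hprod hM hp hpM hL hR hψ hLp hRp hv heq
  -- One good point in each cylinder bounds `v` almost everywhere on that cylinder.
  have hbd : ∀ i : Fin l, ∃ B : ℝ, 0 ≤ B ∧ ∀ᵐ y ∂μ, y.1 0 = i → p (v y) ≤ B := by
    intro i
    by_cases hi : ∃ x : SFT Q, x.1 0 = i ∧ ∀ᵐ y ∂μ, ∀ N, 1 ≤ N → Agree N x y →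
        p (v x - v y) ≤ K * θ ^ N * (1 + p (v x))
    · obtain ⟨x, hxi, hx⟩ := hi
      have hpx : 0 ≤ p (v x) := apply_nonneg p _
      refine ⟨p (v x) + K * θ ^ 1 * (1 + p (v x)), by positivity, ?_⟩
      filter_upwards [hx] with y hy hyi
      have h2 := hy 1 le_rfl (fun n hn => by
        have : n = 0 := by rw [abs_lt] at hn; push_cast at hn; omega
        rw [this, hxi, hyi])
      have h3 := map_sub_le_add p (v x) (v x - v y)
      rw [sub_sub_cancel] at h3
      linarith
    · refine ⟨0, le_rfl, ?_⟩
      filter_upwards [hae] with y hy hyi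
      exact absurd ⟨y, hyi, hy⟩ hi
  choose B hB0 hB using hbd
  have hB' : ∀ᵐ y ∂μ, p (v y) ≤ ∑ i, B i := by
    filter_upwards [ae_all_iff.2 hB] with y hy
    exact (hy _ rfl).trans (Finset.single_le_sum (fun i _ => hB0 i) (Finset.mem_univ _))
  set b := ∑ i, B i
  have hb : 0 ≤ b := Finset.sum_nonneg fun i _ => hB0 i
  refine ⟨{x | (∀ᵐ y ∂μ, ∀ N, 1 ≤ N → Agree N x y →
    p (v x - v y) ≤ K * θ ^ N * (1 + p (v x))) ∧ p (v x) ≤ b}, hae.and hB', θ, h0, h1,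
    2 * (K * (1 + b)) + 2 * b, by positivity, ?_⟩
  rintro N x ⟨hx, hxb⟩ y ⟨hy, hyb⟩ hxy
  refine (hp _).trans ?_
  rcases Nat.eq_zero_or_pos N with rfl | hN
  · have := map_sub_le_add p (v x) (v y)
    have h2 : 0 ≤ 2 * (K * (1 + b)) := by positivity
    simp only [pow_zero, mul_one]
    linarith
  · have hfreq : ∃ᵐ z ∂μ, z ∈ {z | Agree N x z} :=
      frequently_ae_mem_iff.2 ((isOpen_setOf_agree N x).measure_pos μ ⟨x, fun n _ => rfl⟩).ne'
    obtain ⟨z, hz, hxz, hyz⟩ := (hfreq.and_eventually (hx.and hy)).exists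
    have g1 := hxz N hN hz
    have g2 := hyz N hN (hxy.symm.trans hz)
    have t := map_sub_le_add p (v x - v z) (v y - v z)
    rw [sub_sub_sub_cancel_right] at t
    have k1 : K * θ ^ N * (1 + p (v x)) ≤ K * θ ^ N * (1 + b) := by gcongr
    have k2 : K * θ ^ N * (1 + p (v y)) ≤ K * θ ^ N * (1 + b) := by gcongr
    have k3 : 0 ≤ 2 * b * θ ^ N := by positivity
    linarith

end regularity

/-! ### Functions almost everywhere equal to a Hölder function -/

/-- `f` coincides almost everywhere with a Hölder function. -/
def AEHolder {E : Type*} [NormedAddCommGroup E] (μ : Measure (SFT Q)) (f : SFT Q → E) : Prop :=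
  ∃ g, HolderMap g ∧ f =ᵐ[μ] g

section aeHolder

variable {μ : Measure (SFT Q)}

theorem HolderMap.aeHolder {E : Type*} [NormedAddCommGroup E] {f : SFT Q → E}
    (hf : HolderMap f) : AEHolder μ f := ⟨f, hf, EventuallyEq.rfl⟩

theorem AEHolder.mul {f g : SFT Q → ℝ} (hf : AEHolder μ f) (hg : AEHolder μ g) :
    AEHolder μ (fun x => f x * g x) := by
  obtain ⟨f', hf', e⟩ := hf
  obtain ⟨g', hg', e'⟩ := hg
  exact ⟨_, hf'.mul hg', e.mul e'⟩

theorem AEHolder.sub {f g : SFT Q → ℝ} (hf : AEHolder μ f) (hg : AEHolder μ g) :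
    AEHolder μ (fun x => f x - g x) := by
  obtain ⟨f', hf', e⟩ := hf
  obtain ⟨g', hg', e'⟩ := hg
  refine ⟨_, hf'.add ((HolderMap.const (-1)).mul hg'), ?_⟩
  filter_upwards [e, e'] with x hx hx'
  rw [hx, hx']
  ring

theorem AEHolder.sum {ι : Type*} [Fintype ι] {f : ι → SFT Q → ℝ}
    (hf : ∀ i, AEHolder μ (f i)) : AEHolder μ (fun x => ∑ i, f i x) := by
  choose g hg e using hf
  refine ⟨fun x => ∑ i, g i x, HolderMap.sum _ fun i _ => hg i, ?_⟩
  filter_upwards [ae_all_iff.2 e] with x hx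
  exact Finset.sum_congr rfl fun i _ => hx i

theorem AEHolder.comp_shift {E : Type*} [NormedAddCommGroup E]
    (hinv : MeasurePreserving shift μ μ) {f : SFT Q → E} (hf : AEHolder μ f) :
    AEHolder μ (fun x => f (shift x)) := by
  obtain ⟨f', hf', e⟩ := hf
  exact ⟨_, hf'.comp_shift, hinv.quasiMeasurePreserving.ae e⟩

end aeHolder

end SFT

/-! ### Invariant seminorms of bounded groups -/

/-- A bounded group of operators leaves invariant a seminorm equivalent to the norm, the supremum of
the norm over orbits. -/
theorem exists_invariant_seminorm {E : Type*} [NormedAddCommGroup E] [NormedSpace ℝ E]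
    {𝒢 : Set (E →L[ℝ] E)} (h1 : ContinuousLinearMap.id ℝ E ∈ 𝒢)
    (hmul : ∀ g ∈ 𝒢, ∀ h ∈ 𝒢, g.comp h ∈ 𝒢)
    (hinv : ∀ g ∈ 𝒢, ∃ h ∈ 𝒢, ∀ u, h (g u) = u) {M : ℝ} (hM : ∀ g ∈ 𝒢, ∀ u, ‖g u‖ ≤ M * ‖u‖) :
    ∃ p : Seminorm ℝ E, (∀ u, ‖u‖ ≤ p u) ∧ (∀ u, p u ≤ M * ‖u‖) ∧
      ∀ g ∈ 𝒢, ∀ u, p (g u) = p u := by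
  set q : 𝒢 → Seminorm ℝ E := fun g => (normSeminorm ℝ E).comp (g.1 : E →ₗ[ℝ] E) with hq
  have hqa : ∀ g u, q g u = ‖g.1 u‖ := fun g u => rfl
  have : Nonempty 𝒢 := ⟨⟨_, h1⟩⟩
  have hb : BddAbove (Set.range q) := by
    rw [Seminorm.bddAbove_range_iff]
    rintro u
    refine ⟨M * ‖u‖, ?_⟩
    rintro _ ⟨g, rfl⟩
    exact hM g.1 g.2 u
  -- Boundedness matters: an unbounded supremum of seminorms has the junk value `0`.
  have hbu : ∀ u, BddAbove (Set.range fun g => q g u) := Seminorm.bddAbove_range_iff.1 hb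
  have happ : ∀ u, (⨆ g, q g) u = ⨆ g, q g u := fun u => Seminorm.iSup_apply hb
  have hle : ∀ g ∈ 𝒢, ∀ u, (⨆ g, q g) (g u) ≤ (⨆ g, q g) u := by
    intro g hg u
    rw [happ, happ]
    exact ciSup_le fun h => le_ciSup (hbu u) ⟨_, hmul h.1 h.2 g hg⟩
  refine ⟨⨆ g, q g, fun u => ?_, fun u => ?_, fun g hg u => le_antisymm (hle g hg u) ?_⟩
  · rw [happ]
    exact le_ciSup (hbu u) ⟨_, h1⟩
  · rw [happ]
    exact ciSup_le fun g => hM g.1 g.2 u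
  · obtain ⟨h, hh, e⟩ := hinv g hg
    conv_lhs => rw [← e u]
    exact hle h hh (g u)

/-! ### Block diagonal matrices with blocks in compact groups -/

namespace ZimmerBlock

open Matrix

variable {d k : ℕ} {b : Fin d → Fin k}

/-- Matrices whose entries outside the diagonal blocks of `b` vanish. -/
def IsBlockDiag (b : Fin d → Fin k) (M : Matrix (Fin d) (Fin d) ℝ) : Prop :=
  ∀ p q, b p ≠ b q → M p q = 0

theorem IsBlockDiag.ext {M N : Matrix (Fin d) (Fin d) ℝ} (hM : IsBlockDiag b M)
    (hN : IsBlockDiag b N) (h : ∀ i, M.toSquareBlock b i = N.toSquareBlock b i) : M = N := by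
  ext p q
  by_cases hpq : b p = b q
  · exact congrFun (congrFun (h (b q)) ⟨p, hpq⟩) ⟨q, rfl⟩
  · rw [hM p q hpq, hN p q hpq]

theorem IsBlockDiag.mul {M N : Matrix (Fin d) (Fin d) ℝ} (hM : IsBlockDiag b M)
    (hN : IsBlockDiag b N) : IsBlockDiag b (M * N) := by
  intro p q hpq
  rw [Matrix.mul_apply]
  refine Finset.sum_eq_zero fun c _ => ?_
  by_cases hc : b p = b c
  · rw [hN c q (hc ▸ hpq), mul_zero]
  · rw [hM p c hc, zero_mul]

theorem IsBlockDiag.one : IsBlockDiag b (1 : Matrix (Fin d) (Fin d) ℝ) := fun _ _ hpq =>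
  Matrix.one_apply_ne fun h => hpq (congrArg b h)

theorem IsBlockDiag.toSquareBlock_mul {M N : Matrix (Fin d) (Fin d) ℝ} (hM : IsBlockDiag b M)
    (i : Fin k) : (M * N).toSquareBlock b i = M.toSquareBlock b i * N.toSquareBlock b i := by
  ext ⟨p, hp⟩ ⟨q, hq⟩
  change (M * N) p q = ∑ c : {c // b c = i}, M p c * N c q
  rw [Matrix.mul_apply, ← Finset.sum_subtype (Finset.univ.filter fun c => b c = i) (by simp)
    (fun c => M p c * N c q)]
  refine (Finset.sum_filter_of_ne fun c _ hc => ?_).symm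
  by_contra hci
  exact hc (by rw [hM p c (fun h => hci (h.symm.trans hp)), zero_mul])

theorem toSquareBlock_one (i : Fin k) :
    (1 : Matrix (Fin d) (Fin d) ℝ).toSquareBlock b i = 1 := by
  ext ⟨p, hp⟩ ⟨q, hq⟩
  simp [Matrix.toSquareBlock_def, Matrix.one_apply]

/-- Block diagonal matrices with `i`-th diagonal block in `K i`. -/
def blockDiagSet (b : Fin d → Fin k) (K : ∀ i : Fin k, Subgroup (GL {p : Fin d // b p = i} ℝ)) :
    Set (Matrix (Fin d) (Fin d) ℝ) :=
  {M | IsBlockDiag b M ∧ ∀ i, ∃ g ∈ K i,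
    M.toSquareBlock b i = (g : Matrix {p : Fin d // b p = i} {p : Fin d // b p = i} ℝ)}

variable {K : ∀ i : Fin k, Subgroup (GL {p : Fin d // b p = i} ℝ)}

theorem one_mem_blockDiagSet : 1 ∈ blockDiagSet b K :=
  ⟨IsBlockDiag.one, fun i => ⟨1, (K i).one_mem, toSquareBlock_one i⟩⟩

theorem mul_mem_blockDiagSet {M N : Matrix (Fin d) (Fin d) ℝ} (hM : M ∈ blockDiagSet b K)
    (hN : N ∈ blockDiagSet b K) : M * N ∈ blockDiagSet b K := by
  refine ⟨hM.1.mul hN.1, fun i => ?_⟩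
  obtain ⟨g, hg, e⟩ := hM.2 i
  obtain ⟨h, hh, e'⟩ := hN.2 i
  exact ⟨g * h, (K i).mul_mem hg hh, by rw [hM.1.toSquareBlock_mul, e, e', Units.val_mul]⟩

theorem exists_inverse_mem_blockDiagSet {M : Matrix (Fin d) (Fin d) ℝ}
    (hM : M ∈ blockDiagSet b K) : ∃ N ∈ blockDiagSet b K, N * M = 1 ∧ M * N = 1 := by
  choose g hg e using hM.2
  set N : Matrix (Fin d) (Fin d) ℝ := Matrix.of fun p q =>
    if h : b q = b p then ((g (b p))⁻¹).1 ⟨p, rfl⟩ ⟨q, h⟩ else 0 with hN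
  have hNd : IsBlockDiag b N := fun p q hpq => by simp [hN, Ne.symm hpq]
  have hNb : ∀ i, N.toSquareBlock b i = ((g i)⁻¹).1 := by
    intro i
    ext ⟨p, rfl⟩ ⟨q, hq⟩
    change N p q = _
    simp [hN, hq]
  refine ⟨N, ⟨hNd, fun i => ⟨(g i)⁻¹, (K i).inv_mem (hg i), hNb i⟩⟩,
    (hNd.mul hM.1).ext IsBlockDiag.one fun i => ?_, (hM.1.mul hNd).ext IsBlockDiag.one fun i => ?_⟩
  · rw [hNd.toSquareBlock_mul, hNb, e, toSquareBlock_one, Units.inv_mul]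
  · rw [hM.1.toSquareBlock_mul, hNb, e, toSquareBlock_one, Units.mul_inv]

theorem exists_bound_blockDiagSet
    (hK : ∀ i, IsCompact (K i : Set (GL {p : Fin d // b p = i} ℝ))) :
    ∃ R : ℝ, 0 ≤ R ∧ ∀ M ∈ blockDiagSet b K, ∀ p q, |M p q| ≤ R := by
  have h : ∀ i : Fin k, ∀ p q : {p : Fin d // b p = i}, ∃ R : ℝ, ∀ g ∈ K i, |g.1 p q| ≤ R := by
    intro i p q
    have hv : Continuous fun g : GL {p : Fin d // b p = i} ℝ =>
      (g : Matrix {p : Fin d // b p = i} {p : Fin d // b p = i} ℝ) := Units.continuous_val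
    have hc := hv.matrix_elem p q
    obtain ⟨R, hR⟩ := (hK i).exists_bound_of_continuousOn hc.continuousOn
    exact ⟨R, hR⟩
  choose R hR using h
  refine ⟨∑ p, ∑ q, if h : b p = b q then |R (b q) ⟨p, h⟩ ⟨q, rfl⟩| else 0, ?_, ?_⟩
  · refine Finset.sum_nonneg fun p _ => Finset.sum_nonneg fun q _ => ?_
    split_ifs <;> positivity
  · intro M hM p q
    have hnn : ∀ p q, 0 ≤ if h : b p = b q then |R (b q) ⟨p, h⟩ ⟨q, rfl⟩| else 0 := fun p q => by
      split_ifs <;> positivity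
    have hle : |M p q| ≤ if h : b p = b q then |R (b q) ⟨p, h⟩ ⟨q, rfl⟩| else 0 := by
      split_ifs with h
      · obtain ⟨g, hg, e⟩ := hM.2 (b q)
        have e2 : M p q = g.1 ⟨p, h⟩ ⟨q, rfl⟩ := congrFun (congrFun e ⟨p, h⟩) ⟨q, rfl⟩
        rw [e2]
        exact (hR _ _ _ g hg).trans (le_abs_self _)
      · rw [hM.1 p q h, abs_zero]
    refine hle.trans ((Finset.single_le_sum (f := fun q => if h : b p = b q then
      |R (b q) ⟨p, h⟩ ⟨q, rfl⟩| else 0) (fun q _ => hnn p q) (Finset.mem_univ q)).trans ?_)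
    exact Finset.single_le_sum (f := fun p => ∑ q, if h : b p = b q then
      |R (b q) ⟨p, h⟩ ⟨q, rfl⟩| else 0) (fun p _ => Finset.sum_nonneg fun q _ => hnn p q)
      (Finset.mem_univ p)

/-! ### Superdiagonals of block triangular matrices -/

/-- The `r`-th block superdiagonal of `M`, all other entries being replaced by `0`. -/
def superDiag (b : Fin d → Fin k) (r : ℕ) (M : Matrix (Fin d) (Fin d) ℝ) :
    Matrix (Fin d) (Fin d) ℝ :=
  Matrix.of fun p q => if (b q : ℕ) = b p + r then M p q else 0

theorem superDiag_apply (r : ℕ) (M : Matrix (Fin d) (Fin d) ℝ) (p q : Fin d) :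
    superDiag b r M p q = if (b q : ℕ) = b p + r then M p q else 0 := rfl

/-- The contribution to the `r`-th superdiagonal of `M * N` of the entries of `N` on lower
superdiagonals. -/
def leftRem (b : Fin d → Fin k) (r : ℕ) (M N : Matrix (Fin d) (Fin d) ℝ) :
    Matrix (Fin d) (Fin d) ℝ :=
  Matrix.of fun p q => if (b q : ℕ) = b p + r then
    ∑ m, if b p < b m then M p m * N m q else 0 else 0

/-- The contribution to the `r`-th superdiagonal of `M * N` of the entries of `M` on lower
superdiagonals. -/
def rightRem (b : Fin d → Fin k) (r : ℕ) (M N : Matrix (Fin d) (Fin d) ℝ) :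
    Matrix (Fin d) (Fin d) ℝ :=
  Matrix.of fun p q => if (b q : ℕ) = b p + r then
    ∑ m, if b m < b q then M p m * N m q else 0 else 0

theorem superDiag_mul_eq_left {M : Matrix (Fin d) (Fin d) ℝ} (hM : M.BlockTriangular b) (r : ℕ)
    (N : Matrix (Fin d) (Fin d) ℝ) :
    superDiag b r (M * N) = superDiag b 0 M * superDiag b r N + leftRem b r M N := by
  ext p q
  simp only [superDiag, leftRem, Matrix.add_apply, Matrix.mul_apply, Matrix.of_apply, add_zero]
  split_ifs with h
  · rw [← Finset.sum_add_distrib]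
    refine Finset.sum_congr rfl fun m _ => ?_
    rcases lt_trichotomy (b p) (b m) with hm | hm | hm
    · simp [hm, Fin.val_ne_of_ne hm.ne']
    · simp [← hm, h]
    · rw [hM hm]
      simp
  · rw [add_zero]
    refine (Finset.sum_eq_zero fun m _ => ?_).symm
    by_cases hm : (b m : ℕ) = b p
    · rw [hm, if_neg h, mul_zero]
    · rw [if_neg hm, zero_mul]

theorem superDiag_mul_eq_right {N : Matrix (Fin d) (Fin d) ℝ} (hN : N.BlockTriangular b) (r : ℕ)
    (M : Matrix (Fin d) (Fin d) ℝ) :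
    superDiag b r (M * N) = superDiag b r M * superDiag b 0 N + rightRem b r M N := by
  ext p q
  simp only [superDiag, rightRem, Matrix.add_apply, Matrix.mul_apply, Matrix.of_apply, add_zero]
  split_ifs with h
  · rw [← Finset.sum_add_distrib]
    refine Finset.sum_congr rfl fun m _ => ?_
    rcases lt_trichotomy (b m) (b q) with hm | hm | hm
    · simp [hm, Fin.val_ne_of_ne hm.ne']
    · simp [hm, h]
    · rw [hN hm]
      simp
  · rw [add_zero]
    refine (Finset.sum_eq_zero fun m _ => ?_).symm
    by_cases hm : (b q : ℕ) = b m
    · rw [← hm, if_neg h, zero_mul]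
    · rw [if_neg hm, mul_zero]

theorem superDiag_zero_mem_blockDiagSet {M : Matrix (Fin d) (Fin d) ℝ}
    (hM : ∀ i, ∃ g ∈ K i,
      M.toSquareBlock b i = (g : Matrix {p : Fin d // b p = i} {p : Fin d // b p = i} ℝ)) :
    superDiag b 0 M ∈ blockDiagSet b K := by
  refine ⟨fun p q hpq => ?_, fun i => ?_⟩
  · rw [superDiag_apply, if_neg]
    exact fun h => hpq (Fin.ext (by omega))
  · obtain ⟨g, hg, e⟩ := hM i
    refine ⟨g, hg, e ▸ ?_⟩
    ext ⟨p, hp⟩ ⟨q, hq⟩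
    change superDiag b 0 M p q = M p q
    rw [superDiag_apply, if_pos (by rw [hp, hq, add_zero])]

end ZimmerBlock

/-! ### Block triangular conjugacies -/

section conjugacy

open Filter Topology SFT ZimmerBlock

variable {l : ℕ} {Q : Matrix (Fin l) (Fin l) ℤ} {d k : ℕ} {b : Fin d → Fin k}
  {K : ∀ i : Fin k, Subgroup (GL {p : Fin d // b p = i} ℝ)}

/-- Matrix multiplication as a continuous bilinear map. Analysis takes place on the normed space
`Fin d → Fin d → ℝ`, identified with matrices through `Matrix.of`. -/
noncomputable def matrixMulL (d : ℕ) :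
    (Fin d → Fin d → ℝ) →L[ℝ] (Fin d → Fin d → ℝ) →L[ℝ] (Fin d → Fin d → ℝ) :=
  (LinearMap.mk₂ ℝ (fun M N : Fin d → Fin d → ℝ => Matrix.of.symm (Matrix.of M * Matrix.of N))
    (fun M M' N => by rw [← Matrix.of_add_of, Matrix.add_mul]; rfl)
    (fun c M N => by rw [← Matrix.smul_of, Matrix.smul_mul]; rfl)
    (fun M N N' => by rw [← Matrix.of_add_of, Matrix.mul_add]; rfl)
    (fun c M N => by rw [← Matrix.smul_of, Matrix.mul_smul]; rfl)).toContinuousBilinearMap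

theorem matrixMulL_apply (M N : Fin d → Fin d → ℝ) :
    matrixMulL d M N = Matrix.of.symm (Matrix.of M * Matrix.of N) := rfl

/-- Some seminorm equivalent to the norm is invariant under left and right multiplication by the
compact group of block diagonal matrices. -/
theorem exists_blockDiagSet_invariant_seminorm
    (hK : ∀ i, IsCompact (K i : Set (GL {p : Fin d // b p = i} ℝ))) :
    ∃ p : Seminorm ℝ (Fin d → Fin d → ℝ), ∃ M : ℝ, 0 ≤ M ∧ (∀ u, ‖u‖ ≤ p u) ∧
      (∀ u, p u ≤ M * ‖u‖) ∧
      (∀ g ∈ blockDiagSet b K, ∀ u, p (matrixMulL d (Matrix.of.symm g) u) = p u) ∧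
      ∀ g ∈ blockDiagSet b K, ∀ u, p ((matrixMulL d).flip (Matrix.of.symm g) u) = p u := by
  obtain ⟨R, hR0, hR⟩ := exists_bound_blockDiagSet hK
  have hRn : ∀ M ∈ blockDiagSet b K, ‖Matrix.of.symm M‖ ≤ R := fun M hM =>
    (pi_norm_le_iff_of_nonneg hR0).2 fun p => (pi_norm_le_iff_of_nonneg hR0).2 fun q =>
      hR M hM p q
  set m := ‖matrixMulL d‖
  have hmul : ∀ M N, ‖matrixMulL d M N‖ ≤ m * ‖M‖ * ‖N‖ := (matrixMulL d).le_opNorm₂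
  set 𝒢 : Set ((Fin d → Fin d → ℝ) →L[ℝ] (Fin d → Fin d → ℝ)) :=
    {T | ∃ g ∈ blockDiagSet b K, ∃ h ∈ blockDiagSet b K,
      ∀ u, T u = Matrix.of.symm (g * Matrix.of u * h)}
  obtain ⟨p, hp1, hp2, hp⟩ := exists_invariant_seminorm (𝒢 := 𝒢) (M := m * (m * R) * R)
    ⟨1, one_mem_blockDiagSet, 1, one_mem_blockDiagSet, fun u => by simp⟩
    (by
      rintro T ⟨g, hg, h, hh, e⟩ T' ⟨g', hg', h', hh', e'⟩
      exact ⟨g * g', mul_mem_blockDiagSet hg hg', h' * h, mul_mem_blockDiagSet hh' hh,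
        fun u => by
          simp only [ContinuousLinearMap.comp_apply, e, e', Matrix.mul_assoc,
            Equiv.apply_symm_apply]⟩)
    (by
      rintro T ⟨g, hg, h, hh, e⟩
      obtain ⟨g', hg', hgg', -⟩ := exists_inverse_mem_blockDiagSet hg
      obtain ⟨h', hh', -, hhh'⟩ := exists_inverse_mem_blockDiagSet hh
      have hT : ∀ u, ((matrixMulL d (Matrix.of.symm g')).comp
          ((matrixMulL d).flip (Matrix.of.symm h'))) u =
          Matrix.of.symm (g' * Matrix.of u * h') := fun u => by
        simp only [ContinuousLinearMap.comp_apply, ContinuousLinearMap.flip_apply,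
          matrixMulL_apply, Equiv.apply_symm_apply, Matrix.mul_assoc]
      refine ⟨_, ⟨g', hg', h', hh', hT⟩, fun u => ?_⟩
      rw [hT, e, Equiv.apply_symm_apply, ← Matrix.mul_assoc, ← Matrix.mul_assoc, hgg',
        Matrix.one_mul, Matrix.mul_assoc, hhh', Matrix.mul_one, Equiv.symm_apply_apply])
    (by
      rintro T ⟨g, hg, h, hh, e⟩ u
      have hT : T u = matrixMulL d (matrixMulL d (Matrix.of.symm g) u) (Matrix.of.symm h) := by
        simp only [e, matrixMulL_apply, Equiv.apply_symm_apply]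
      rw [hT]
      calc _ ≤ m * (m * ‖Matrix.of.symm g‖ * ‖u‖) * ‖Matrix.of.symm h‖ :=
            (hmul _ _).trans (by gcongr; exact hmul _ u)
        _ ≤ m * (m * R * ‖u‖) * R := by gcongr; exacts [hRn g hg, hRn h hh]
        _ = _ := by ring)
  refine ⟨p, m * (m * R) * R, by positivity, hp1, hp2, fun g hg u => ?_, fun g hg u => ?_⟩
  · exact hp _ ⟨g, hg, 1, one_mem_blockDiagSet, fun u => by simp [matrixMulL_apply]⟩ u
  · exact hp _ ⟨1, one_mem_blockDiagSet, g, hg, fun u => by simp [matrixMulL_apply]⟩ u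

theorem holderMap_matrix {f : SFT Q → Matrix (Fin d) (Fin d) ℝ}
    (hf : ∀ p q, HolderMap (fun x => f x p q)) : HolderMap (fun x => Matrix.of.symm (f x)) :=
  HolderMap.pi fun p => HolderMap.pi fun q => hf p q

theorem holderMap_superDiag {f : SFT Q → Matrix (Fin d) (Fin d) ℝ}
    (hf : ∀ p q, HolderMap (fun x => f x p q)) (r : ℕ) :
    HolderMap (fun x => Matrix.of.symm (superDiag b r (f x))) := by
  refine holderMap_matrix fun p q => ?_
  simp only [superDiag_apply]
  split_ifs
  exacts [hf p q, HolderMap.const 0]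

/-- One superdiagonal of the conjugacy: it solves an affine equation whose linear part is isometric
for an invariant seminorm, and whose inhomogeneous part `ψ` is Hölder. -/
theorem aeHolder_of_isometric_equation {μ : Measure (SFT Q)} [IsProbabilityMeasure μ]
    (hinv : MeasurePreserving shift μ μ) (hsupp : μ.IsOpenPosMeasure)
    (hprod : HasContinuousProductStructure μ)
    (hK : ∀ i, IsCompact (K i : Set (GL {p : Fin d // b p = i} ℝ)))
    {D D' v ψ : SFT Q → Matrix (Fin d) (Fin d) ℝ} 
    (hD : HolderMap (fun x => Matrix.of.symm (D x)))
    (hD' : HolderMap (fun x => Matrix.of.symm (D' x)))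
    (hDK : ∀ x, D x ∈ blockDiagSet b K) (hDK' : ∀ x, D' x ∈ blockDiagSet b K)
    (hv : ∀ p q, AEMeasurable (fun x => v x p q) μ)
    (hψ : ∀ p q, AEHolder μ (fun x => ψ x p q))
    (heq : ∀ᵐ x ∂μ, v (shift x) * D' x = D x * v x + ψ x) (p q : Fin d) :
    AEHolder μ (fun x => v x p q) := by
  obtain ⟨s, M, hM, hs, hsM, hsl, hsr⟩ := exists_blockDiagSet_invariant_seminorm hK
  choose ψ' hψ' e using hψ
  set w : SFT Q → Fin d → Fin d → ℝ := fun x p q => (hv p q).mk _ x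
  have hw : Measurable w :=
    measurable_pi_lambda _ fun p => measurable_pi_lambda _ fun q => (hv p q).measurable_mk
  have hvw : ∀ᵐ x ∂μ, v x = Matrix.of (w x) := by
    filter_upwards [ae_all_iff.2 fun p => ae_all_iff.2 fun q => (hv p q).ae_eq_mk] with x hx
    ext p q
    exact hx p q
  have heq' : ∀ᵐ x ∂μ, (matrixMulL d).flip (Matrix.of.symm (D' x)) (w (shift x)) =
      matrixMulL d (Matrix.of.symm (D x)) (w x) + fun p q => ψ' p q x := by
    filter_upwards [heq, hvw, hinv.quasiMeasurePreserving.ae hvw,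
      ae_all_iff.2 fun p => ae_all_iff.2 fun q => e p q] with x h1 h2 h3 h4
    rw [ContinuousLinearMap.flip_apply, matrixMulL_apply, matrixMulL_apply,
      Equiv.apply_symm_apply, Equiv.apply_symm_apply, ← h2, ← h3, h1]
    funext p q
    exact congrArg ((D x * v x) p q + ·) (h4 p q)
  obtain ⟨G, hG, θ, h0, h1, c, hc, hest⟩ := exists_ae_mem_norm_sub_le hinv hsupp hprod hM hs hsM
    (hD.clm_comp (matrixMulL d)) (hD'.clm_comp (matrixMulL d).flip)
    (HolderMap.pi fun p => HolderMap.pi fun q => hψ' p q)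
    (fun x u => hsl _ (hDK x) u) (fun x u => hsr _ (hDK' x) u) hw heq'
  obtain ⟨g, hg, hwg⟩ := exists_holderMap_extend (f := fun x => w x p q) h0 h1 hc
    fun N x hx y hy hxy => ((norm_le_pi_norm ((w x - w y) p) q).trans
      (norm_le_pi_norm (w x - w y) p)).trans (hest N x hx y hy hxy)
  refine ⟨g, hg, ?_⟩
  filter_upwards [hG, hvw] with x hx hvx
  rw [← hwg x hx, hvx]
  rfl

/-- The entries of the conjugacy are Hölder almost everywhere, by induction on the superdiagonal:
modulo lower superdiagonals, the `r`-th superdiagonal `v` of `C` satisfies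
`v (shift x) * D' x = D x * v x` with `D`, `D'` the block diagonal parts of `A`, `B`. -/
theorem aeHolder_entry_of_conjugacy {μ : Measure (SFT Q)} [IsProbabilityMeasure μ]
    (hinv : MeasurePreserving shift μ μ) (hsupp : μ.IsOpenPosMeasure)
    (hprod : HasContinuousProductStructure μ)
    (hK : ∀ i, IsCompact (K i : Set (GL {p : Fin d // b p = i} ℝ)))
    {A B C : SFT Q → Matrix (Fin d) (Fin d) ℝ}
    (hA : ∀ p q, HolderMap (fun x => A x p q)) (hB : ∀ p q, HolderMap (fun x => B x p q))
    (hAT : ∀ x, (A x).BlockTriangular b) (hBT : ∀ x, (B x).BlockTriangular b)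
    (hCT : ∀ x, (C x).BlockTriangular b)
    (hAK : ∀ x i, ∃ g ∈ K i, (A x).toSquareBlock b i =
      (g : Matrix {p : Fin d // b p = i} {p : Fin d // b p = i} ℝ))
    (hBK : ∀ x i, ∃ g ∈ K i, (B x).toSquareBlock b i =
      (g : Matrix {p : Fin d // b p = i} {p : Fin d // b p = i} ℝ))
    (hC : ∀ p q, AEMeasurable (fun x => C x p q) μ)
    (heq : ∀ᵐ x ∂μ, A x * C x = C (shift x) * B x) (p q : Fin d) :
    AEHolder μ (fun x => C x p q) := by
  suffices h : ∀ r : ℕ, ∀ p q : Fin d, (b q : ℕ) < b p + r → AEHolder μ (fun x => C x p q) from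
    h k p q (by have := (b q).2; omega)
  intro r
  induction r with
  | zero =>
    intro p q hpq
    have h0 : ∀ x, C x p q = 0 := fun x => hCT x (Fin.lt_def.2 hpq)
    simp only [h0]
    exact (HolderMap.const 0).aeHolder
  | succ r ih =>
    intro p q hpq
    rcases Nat.lt_or_ge (b q : ℕ) (b p + r) with hlt | hge
    · exact ih p q hlt
    have hz : AEHolder μ (fun _ : SFT Q => (0 : ℝ)) := (HolderMap.const 0).aeHolder
    have hψ : ∀ p q, AEHolder μ (fun x =>
        (leftRem b r (A x) (C x) - rightRem b r (C (shift x)) (B x)) p q) := by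
      intro p q
      by_cases hr : (b q : ℕ) = b p + r
      · simp only [Matrix.sub_apply, leftRem, rightRem, Matrix.of_apply, if_pos hr]
        refine AEHolder.sub (AEHolder.sum fun m => ?_) (AEHolder.sum fun m => ?_)
        · split_ifs with hm
          · exact (hA p m).aeHolder.mul (ih m q (by have := Fin.lt_def.1 hm; omega))
          · exact hz
        · split_ifs with hm
          · exact ((ih p m (by have := Fin.lt_def.1 hm; omega)).comp_shift hinv).mul
              (hB m q).aeHolder
          · exact hz
      · simpa only [Matrix.sub_apply, leftRem, rightRem, Matrix.of_apply, if_neg hr, sub_zero]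
          using hz
    have hv : ∀ p q, AEMeasurable (fun x => superDiag b r (C x) p q) μ := by
      intro p q
      simp only [superDiag_apply]
      split_ifs
      exacts [hC p q, aemeasurable_const]
    have heq' : ∀ᵐ x ∂μ, superDiag b r (C (shift x)) * superDiag b 0 (B x) =
        superDiag b 0 (A x) * superDiag b r (C x) +
          (leftRem b r (A x) (C x) - rightRem b r (C (shift x)) (B x)) := by
      filter_upwards [heq] with x hx
      rw [add_sub, ← superDiag_mul_eq_left (hAT x), hx, superDiag_mul_eq_right (hBT x),
        add_sub_cancel_right]
    have := aeHolder_of_isometric_equation hinv hsupp hprod hK (v := fun x => superDiag b r (C x))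
      (holderMap_superDiag hA 0) (holderMap_superDiag hB 0)
      (fun x => superDiag_zero_mem_blockDiagSet (hAK x))
      (fun x => superDiag_zero_mem_blockDiagSet (hBK x)) hv hψ heq' p q
    simpa only [superDiag_apply, if_pos (show (b q : ℕ) = b p + r by omega)] using this

end conjugacy

/-! ### Closedness of Zimmer blocks and the conjugacy theorem -/

/-- The matrices of a Zimmer block form a closed set of matrices. -/
theorem ZimmerBlock.isClosed_setOf {d k : ℕ} {b : Fin d → Fin k}
    {K : ∀ i : Fin k, Subgroup (GL {p : Fin d // b p = i} ℝ)} (lam : ℝ)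
    (hK : ∀ i, IsCompact (K i : Set (GL {p : Fin d // b p = i} ℝ))) :
    IsClosed {M : Matrix (Fin d) (Fin d) ℝ | M.BlockTriangular b ∧ ∀ i : Fin k, ∃ g ∈ K i,
      M.toSquareBlock b i =
        Real.exp lam • (g : Matrix {p : Fin d // b p = i} {p : Fin d // b p = i} ℝ)} := by
  refine IsClosed.inter ?_ ?_
  · change IsClosed {M : Matrix (Fin d) (Fin d) ℝ | ∀ ⦃p q⦄, b q < b p → M p q = 0}
    simp only [Set.ofPred_forall]
    refine isClosed_iInter fun p => isClosed_iInter fun q => isClosed_iInter fun _ => ?_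
    exact isClosed_eq (continuous_id.matrix_elem p q) continuous_const
  · change IsClosed {M : Matrix (Fin d) (Fin d) ℝ | ∀ i : Fin k, _}
    rw [Set.ofPred_forall]
    refine isClosed_iInter fun i => ?_
    have hv : Continuous fun g : GL {p : Fin d // b p = i} ℝ =>
      (g : Matrix {p : Fin d // b p = i} {p : Fin d // b p = i} ℝ) := Units.continuous_val
    have hc : Continuous fun M : Matrix (Fin d) (Fin d) ℝ => M.toSquareBlock b i :=
      continuous_id.matrix_submatrix _ _
    convert ((hK i).image
      ((continuous_const_smul (Real.exp lam)).comp hv)).isClosed.preimage hc using 1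
    ext M
    exact exists_congr fun g => and_congr_right fun _ => eq_comm

theorem ZimmerBlock.det_ne_zero {d k : ℕ} {b : Fin d → Fin k} {lam : ℝ}
    {M : Matrix (Fin d) (Fin d) ℝ} (hM : M.BlockTriangular b)
    (h : ∀ i : Fin k, ∃ g : GL {p : Fin d // b p = i} ℝ, M.toSquareBlock b i =
      Real.exp lam • (g : Matrix {p : Fin d // b p = i} {p : Fin d // b p = i} ℝ)) :
    M.det ≠ 0 := by
  rw [hM.det_fintype, Finset.prod_ne_zero_iff]
  intro i _
  obtain ⟨g, e⟩ := h i
  rw [e, Matrix.det_smul]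
  exact mul_ne_zero (pow_ne_zero _ (Real.exp_pos _).ne')
    ((Matrix.isUnit_iff_isUnit_det _).1 g.isUnit).ne_zero

theorem mainTheorem3
    {l : ℕ} (Q : Matrix (Fin l) (Fin l) ℤ)
    (hQ01 : ∀ i j, Q i j = 0 ∨ Q i j = 1) (hQ : Q.IsIrreducible)
    (μ : Measure (SFT Q)) [IsProbabilityMeasure μ]
    (hinv : MeasurePreserving SFT.shift μ μ)
    (hsupp : μ.IsOpenPosMeasure)
    (hprod : SFT.HasContinuousProductStructure μ)
    {d : ℕ} (lam : ℝ) (U : Set (GL (Fin d) ℝ)) (hU : IsZimmerBlock lam U)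
    (A B : SFT Q → GL (Fin d) ℝ)
    (hAU : ∀ x, A x ∈ U) (hBU : ∀ x, B x ∈ U)
    (hA : SFT.IsHolder A) (hB : SFT.IsHolder B)
    (C : SFT Q → GL (Fin d) ℝ) (hCU : ∀ x, C x ∈ U)
    (hC : SFT.IsAEMeasurableGL μ C)
    (hconj : ∀ᵐ x ∂μ, A x = C (SFT.shift x) * B x * (C x)⁻¹) :
    ∃ C' : SFT Q → GL (Fin d) ℝ,
      SFT.IsHolder C' ∧ (∀ x, C' x ∈ U) ∧ ∀ᵐ x ∂μ, C x = C' x := by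
  obtain ⟨k, b, -, -, K, hK, hU⟩ := hU
  -- Dividing `A` and `B` by `e ^ lam` puts their diagonal blocks into the compact groups.
  have hblock : ∀ F : SFT Q → GL (Fin d) ℝ, (∀ x, F x ∈ U) → ∀ x i, ∃ g ∈ K i,
      (Real.exp (-lam) • (F x : Matrix (Fin d) (Fin d) ℝ)).toSquareBlock b i =
        (g : Matrix {p : Fin d // b p = i} {p : Fin d // b p = i} ℝ) := by
    intro F hF x i
    obtain ⟨g, hg, e⟩ := ((hU _).1 (hF x)).2 i
    refine ⟨g, hg, ?_⟩
    change Real.exp (-lam) • (F x : Matrix (Fin d) (Fin d) ℝ).toSquareBlock b i = _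
    rw [e, smul_smul, ← Real.exp_add, neg_add_cancel, Real.exp_zero, one_smul]
  have htri : ∀ F : SFT Q → GL (Fin d) ℝ, (∀ x, F x ∈ U) → ∀ x,
      (Real.exp (-lam) • (F x : Matrix (Fin d) (Fin d) ℝ)).BlockTriangular b := by
    intro F hF x p q hpq
    rw [Matrix.smul_apply, ((hU _).1 (hF x)).1 hpq, smul_zero]
  have hhol : ∀ F : SFT Q → GL (Fin d) ℝ, SFT.IsHolder F → ∀ p q, SFT.HolderMap (fun x =>
      (Real.exp (-lam) • (F x : Matrix (Fin d) (Fin d) ℝ)) p q) := fun F hF p q =>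
    (SFT.HolderMap.const (Real.exp (-lam))).mul (hF.holderMap_entry p q)
  have hconj' : ∀ᵐ x ∂μ, (Real.exp (-lam) • (A x : Matrix (Fin d) (Fin d) ℝ)) *
      (C x : Matrix (Fin d) (Fin d) ℝ) = (C (SFT.shift x) : Matrix (Fin d) (Fin d) ℝ) *
      (Real.exp (-lam) • (B x : Matrix (Fin d) (Fin d) ℝ)) := by
    filter_upwards [hconj] with x hx
    rw [Matrix.smul_mul, Matrix.mul_smul, ← Units.val_mul, ← Units.val_mul, hx,
      inv_mul_cancel_right]
  have hent := fun p q => aeHolder_entry_of_conjugacy (K := K) hinv hsupp hprod hK (hhol A hA)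
    (hhol B hB) (htri A hAU) (htri B hBU) (fun x => ((hU _).1 (hCU x)).1) (hblock A hAU)
    (hblock B hBU) hC hconj' p q
  choose g hg e using hent
  set N : SFT Q → Matrix (Fin d) (Fin d) ℝ := fun x => Matrix.of fun p q => g p q x with hN
  have hCN : ∀ᵐ x ∂μ, (C x : Matrix (Fin d) (Fin d) ℝ) = N x := by
    filter_upwards [ae_all_iff.2 fun p => ae_all_iff.2 fun q => e p q] with x hx
    ext p q
    exact hx p q
  have hNc : Continuous N := continuous_matrix fun p q => (hg p q).continuous
  -- The block structure is a closed condition which holds almost everywhere, hence everywhere.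
  have hNU := ((ZimmerBlock.isClosed_setOf lam hK).preimage hNc).ae_eq_univ_iff_eq.1
    (Filter.eventuallyEq_univ.2 (by
      filter_upwards [hCN] with x hx
      rw [Set.mem_preimage, ← hx]
      exact (hU _).1 (hCU x)))
  have hNx : ∀ x, (N x).BlockTriangular b ∧ ∀ i : Fin k, ∃ g ∈ K i, (N x).toSquareBlock b i =
      Real.exp lam • (g : Matrix {p : Fin d // b p = i} {p : Fin d // b p = i} ℝ) := fun x =>
    Set.eq_univ_iff_forall.1 hNU x
  have hdet : ∀ x, (N x).det ≠ 0 := fun x => ZimmerBlock.det_ne_zero (hNx x).1 fun i => by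
    obtain ⟨g, -, e⟩ := (hNx x).2 i
    exact ⟨g, e⟩
  refine ⟨fun x => Matrix.GeneralLinearGroup.mkOfDetNeZero (N x) (hdet x), ?_, ?_, ?_⟩
  · exact SFT.isHolder_of_holderMap (SFT.HolderMap.pi fun p => SFT.HolderMap.pi fun q => hg p q)
  · exact fun x => (hU _).2 (hNx x)
  · filter_upwards [hCN] with x hx
    exact Units.ext hx
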